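/- **Setting.** Let $n\ge 2$, let $(M,g)$ be a $C^\infty$ Lorentzian $(n+1)$-manifold of signature $(-,+,\dots,+)$ with Levi-Civita connection $D$, and let $F$ be a $C^3$ immersion from an open neighbourhood $U$ of a point $o\in\mathbb R^n$ (coordinates $u_1,\dots,u_n$) into $M$. Put $$s_{ij}=g(F_{u_i},F_{u_j}),\qquad B_F=\det(s_{ij}).$$ A point $q\in U$ is a *light-like point* if $B_F(q)=0$ (i.e. the induced metric is degenerate at $q$); it is a *degenerate light-like point* if moreover $dB_F(q)=0$. With a local orientation of $M$ given by a chart, let $\tilde\nu$ be the normal vector field along $F$ determined by $g(v,\tilde\nu)=\mathrm{vol}_g(v,F_{u_1},\dots,F_{u_n})$ for all $v$ (so $g(\tilde\nu,\tilde\nu)=-B_F$), and put $$A_F=\sum_{i,j=1}^n \tilde s^{ij}\,g(D_{\partial_{u_i}}F_{u_j},\tilde\nu),$$ where $(\tilde s^{ij})$ is the cofactor matrix of $(s_{ij})$. The mean curvature of $F$ at a point that is not light-like is $H=\frac1n\sum_{i,j}s^{ij}g(D_{\partial_{u_i}}F_{u_j},\nu)$, where $(s^{ij})=(s_{ij})^{-1}$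 and $\nu=\tilde\nu/\sqrt{|B_F|}$; it is defined up to sign. $F$ has *zero mean curvature* on $U$ if $H=0$ at all points of $U$ that are not light-like. The class $\mathcal X^3_0(M,\hat o)$, $\hat o=F(o)$, consists of the germs at $o$ of $C^3$ immersions $F$ for which there is a $C^1$ function $\varphi$ near $o$ with $A_F=\varphi B_F$ near $o$. **Theorem.** Let $o$ be a degenerate light-like point of $F$. 1. If the germ of $F$ at $o$ belongs to $\mathcal X^3_0(M,\hat o)$, then the image of $F$ (restricted to an arbitrarily small neighbourhood of $o$) contains a light-like geodesic segment of $M$ through $F(o)$ consisting of degenerate light-like points only. 2. In particular, if $F$ is a $C^3$ immersion on the open set $U\ni o$ with zero mean curvature, then $F(U)$ contains a light-like geodesic segment of $M$ through $F(o)$ consisting of degenerate light-like points only. Precisely: for every neighbourhood $V$ of $o$ in case 1, and for $V=U$ in case 2, there are $\varepsilon>0$ and a continuous curve $c:(-\varepsilon,\varepsilon)\to V$ with $c(0)=o$ such that every $c(t)$ is a degenerate light-like point of $F$ and $F\circ c$ is a geodesic of $M$ whose velocity is everywhere a non-zero null vector. -/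

import Mathlib

open scoped Manifold ContDiff Topology

attribute [local instance 2000] chartedSpaceSelf

namespace LorentzHypersurface

noncomputable section

/-- The Euclidean space `ℝ^m` with its standard coordinates. -/
abbrev Euc (m : ℕ) : Type := EuclideanSpace ℝ (Fin m)

/-- The `i`-th standard basis vector of `ℝ^m`. -/
def stdVec {m : ℕ} (i : Fin m) : Euc m := EuclideanSpace.single i (1 : ℝ)

/-- The partial derivative `∂f/∂u_i` at `q` of a real function on `ℝ^m`. -/
def pd {m : ℕ} (i : Fin m) (f : Euc m → ℝ) (q : Euc m) : ℝ := fderiv ℝ f q (stdVec i)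

/-! ### The metric in a chart -/

variable {n : ℕ} {M : Type*} [TopologicalSpace M] [ChartedSpace (Euc (n + 1)) M]

/-- The coordinate vector field `∂/∂x_α` of the preferred chart at `p`, at the point of `M` with
coordinates `y`. -/
def coordVec (p : M) (y : Euc (n + 1)) (α : Fin (n + 1)) :
    TangentSpace 𝓘(ℝ, Euc (n + 1)) ((extChartAt 𝓘(ℝ, Euc (n + 1)) p).symm y) :=
  mfderiv 𝓘(ℝ, Euc (n + 1)) 𝓘(ℝ, Euc (n + 1)) (extChartAt 𝓘(ℝ, Euc (n + 1)) p).symm y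
    (stdVec α : Euc (n + 1))

/-- A `C^∞` Lorentzian metric of signature `(-,+,…,+)` on an `(n+1)`-manifold `M`: a symmetric bilinear
form on each tangent space, with a basis `e_0, …, e_n` such that `⟨e_0, e_0⟩ = -1`, `⟨e_i, e_i⟩ = 1`
for `i ≥ 1` and `⟨e_i, e_j⟩ = 0` for `i ≠ j`, whose coefficients `g(∂/∂x_α, ∂/∂x_β)` are `C^∞`
functions of the coordinates in each of the charts. -/
structure LorentzianMetric (n : ℕ) (M : Type*) [TopologicalSpace M]
    [ChartedSpace (Euc (n + 1)) M] [IsManifold 𝓘(ℝ, Euc (n + 1)) ∞ M] where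
  /-- The scalar product on each tangent space. -/
  inner (p : M) : TangentSpace 𝓘(ℝ, Euc (n + 1)) p →L[ℝ] TangentSpace 𝓘(ℝ, Euc (n + 1)) p →L[ℝ] ℝ
  symm (p : M) (v w : TangentSpace 𝓘(ℝ, Euc (n + 1)) p) : inner p v w = inner p w v
  signature (p : M) : ∃ e : Module.Basis (Fin (n + 1)) ℝ (TangentSpace 𝓘(ℝ, Euc (n + 1)) p),
    ∀ i j, inner p (e i) (e j) = if i = j then (if i = 0 then (-1 : ℝ) else 1) else 0
  smooth (p : M) (α β : Fin (n + 1)) :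
    ContDiffOn ℝ ∞ (fun y ↦ inner ((extChartAt 𝓘(ℝ, Euc (n + 1)) p).symm y)
      (coordVec p y α) (coordVec p y β)) (extChartAt 𝓘(ℝ, Euc (n + 1)) p).target

variable [IsManifold 𝓘(ℝ, Euc (n + 1)) ∞ M]

/-- The metric coefficients `g_{αβ} = g(∂/∂x_α, ∂/∂x_β)` in the preferred chart at `p`, as functions
of the coordinates `y`. -/
def metricCoeff (g : LorentzianMetric n M) (p : M) (y : Euc (n + 1)) :
    Matrix (Fin (n + 1)) (Fin (n + 1)) ℝ :=
  Matrix.of fun α β ↦ g.inner ((extChartAt 𝓘(ℝ, Euc (n + 1)) p).symm y)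
    (coordVec p y α) (coordVec p y β)

/-- The Christoffel symbols `Γ^k_{αβ}` of the Levi-Civita connection in the preferred chart
at `p`. -/
def christoffel (g : LorentzianMetric n M) (p : M) (y : Euc (n + 1)) (k α β : Fin (n + 1)) : ℝ :=
  (1 / 2 : ℝ) * ∑ l, (metricCoeff g p y)⁻¹ k l *
    (pd α (fun z ↦ metricCoeff g p z β l) y + pd β (fun z ↦ metricCoeff g p z α l) y
      - pd l (fun z ↦ metricCoeff g p z α β) y)

/-! ### The first fundamental form and light-like points -/

/-- The coefficients `s_{ij} = g(F_{u_i}, F_{u_j})` of the induced metric of `F`. -/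
def firstForm (g : LorentzianMetric n M) (F : Euc n → M) (q : Euc n) :
    Matrix (Fin n) (Fin n) ℝ :=
  Matrix.of fun i j ↦ g.inner (F q)
    (mfderiv 𝓘(ℝ, Euc n) 𝓘(ℝ, Euc (n + 1)) F q (stdVec i : Euc n))
    (mfderiv 𝓘(ℝ, Euc n) 𝓘(ℝ, Euc (n + 1)) F q (stdVec j : Euc n))

/-- The function `B_F = det (s_{ij})`. -/
def BF (g : LorentzianMetric n M) (F : Euc n → M) (q : Euc n) : ℝ := (firstForm g F q).det

/-- `q` is a light-like point of `F` if the induced metric is degenerate at `q`. -/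
def IsLightlikePoint (g : LorentzianMetric n M) (F : Euc n → M) (q : Euc n) : Prop :=
  BF g F q = 0

/-- A light-like point is degenerate if the exterior derivative of `B_F` vanishes there. -/
def IsDegenerateLightlikePoint (g : LorentzianMetric n M) (F : Euc n → M) (q : Euc n) : Prop :=
  IsLightlikePoint g F q ∧ fderiv ℝ (BF g F) q = 0

/-! ### The second fundamental form, in the preferred chart at a point `p`

In this part `F q` is meant to lie in the domain of the preferred chart at `p`. -/

/-- The `α`-th coordinate of `F` in the preferred chart at `p`. -/
def coord (p : M) (F : Euc n → M) (α : Fin (n + 1)) (q : Euc n) : ℝ :=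
  extChartAt 𝓘(ℝ, Euc (n + 1)) p (F q) α

/-- The components of `D_{∂/∂u_i} F_{u_j}`, with `D` the Levi-Civita connection. -/
def covDeriv (g : LorentzianMetric n M) (p : M) (F : Euc n → M) (q : Euc n) (i j : Fin n)
    (k : Fin (n + 1)) : ℝ :=
  pd i (pd j (coord p F k)) q +
    ∑ α, ∑ β, christoffel g p (extChartAt 𝓘(ℝ, Euc (n + 1)) p (F q)) k α β *
      pd i (coord p F α) q * pd j (coord p F β) q

/-- The volume form of `g` in the preferred chart at `p` (oriented by the chart), evaluated on
`(v, F_{u_1}, …, F_{u_n})`. -/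
def volForm (g : LorentzianMetric n M) (p : M) (F : Euc n → M) (q : Euc n)
    (v : Fin (n + 1) → ℝ) : ℝ :=
  Real.sqrt |(metricCoeff g p (extChartAt 𝓘(ℝ, Euc (n + 1)) p (F q))).det| *
    (Matrix.of (Matrix.vecCons v fun i α ↦ pd i (coord p F α) q)).det

/-- The components of the normal vector field `ν̃`, the Lorentzian vector product of
`F_{u_1}, …, F_{u_n}`: it is determined by `g(v, ν̃) = vol(v, F_{u_1}, …, F_{u_n})` for all `v`.
It has no zeros on an immersion, and `g(ν̃, ν̃) = -B_F`. -/
def normalVec (g : LorentzianMetric n M) (p : M) (F : Euc n → M) (q : Euc n)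
    (k : Fin (n + 1)) : ℝ :=
  ∑ l, (metricCoeff g p (extChartAt 𝓘(ℝ, Euc (n + 1)) p (F q)))⁻¹ k l *
    volForm g p F q (Pi.single l 1)

/-- `h̃_{ij} = g(D_{∂/∂u_i} F_{u_j}, ν̃)`. -/
def secondForm (g : LorentzianMetric n M) (p : M) (F : Euc n → M) (q : Euc n) :
    Matrix (Fin n) (Fin n) ℝ :=
  Matrix.of fun i j ↦ ∑ α, ∑ β, metricCoeff g p (extChartAt 𝓘(ℝ, Euc (n + 1)) p (F q)) α β *
    covDeriv g p F q i j α * normalVec g p F q β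

/-- The function `A_F = ∑ s̃^{ij} h̃_{ij}`, where `(s̃^{ij})` is the cofactor matrix
of `(s_{ij})`. -/
def AF (g : LorentzianMetric n M) (p : M) (F : Euc n → M) (q : Euc n) : ℝ :=
  ∑ i, ∑ j, (firstForm g F q).adjugate i j * secondForm g p F q i j

/-- The mean curvature of `F` at a point `q` with `B_F(q) ≠ 0`, with respect to the unit normal
vector `ν̃ / √|B_F|`: one `n`-th of the trace of the second fundamental form with respect to the
first one. It is computed in the preferred chart at `F q`; another chart changes at most its
sign. -/
def meanCurvature (g : LorentzianMetric n M) (F : Euc n → M) (q : Euc n) : ℝ :=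
  (1 / (n : ℝ)) * ∑ i, ∑ j, (firstForm g F q)⁻¹ i j *
    (secondForm g (F q) F q i j / Real.sqrt |BF g F q|)

/-! ### The classes of hypersurfaces -/

/-- `F` is a `C^3` immersion on the open set `U`. -/
structure IsC3ImmersionOn (F : Euc n → M) (U : Set (Euc n)) : Prop where
  contMDiffOn : ContMDiffOn 𝓘(ℝ, Euc n) 𝓘(ℝ, Euc (n + 1)) 3 F U
  injective : ∀ q ∈ U, Function.Injective (mfderiv 𝓘(ℝ, Euc n) 𝓘(ℝ, Euc (n + 1)) F q)

/-- The class of germs at `o` of `C^3` immersions `F` such that `A_F = φ B_F` near `o` for some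
`C^1` function `φ`. Here `A_F` is computed in the preferred chart at `F o` (another chart
around `F o` changes at most its sign). -/
structure InClassX3 (g : LorentzianMetric n M) (F : Euc n → M) (o : Euc n) : Prop where
  immersion : ∃ U : Set (Euc n), IsOpen U ∧ o ∈ U ∧ IsC3ImmersionOn F U
  factor : ∃ φ : Euc n → ℝ, ContDiffAt ℝ 1 φ o ∧ ∀ᶠ q in 𝓝 o, AF g (F o) F q = φ q * BF g F q

/-- `F` is a `C^3` zero mean curvature immersion on `U`: the mean curvature vanishes wherever it is
defined, i.e. at all points that are not light-like. -/
structure IsC3ZeroMeanCurvatureOn (g : LorentzianMetric n M) (F : Euc n → M)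
    (U : Set (Euc n)) : Prop where
  immersion : IsC3ImmersionOn F U
  meanCurvature_eq_zero : ∀ q ∈ U, ¬ IsLightlikePoint g F q → meanCurvature g F q = 0

/-! ### Geodesics -/

/-- The components of the covariant acceleration `D γ'/dt` at time `t`, in the preferred chart
at `γ t`. -/
def covAccel (g : LorentzianMetric n M) (γ : ℝ → M) (t : ℝ) (k : Fin (n + 1)) : ℝ :=
  let x : Fin (n + 1) → ℝ → ℝ := fun α s ↦ extChartAt 𝓘(ℝ, Euc (n + 1)) (γ t) (γ s) α
  deriv (deriv (x k)) t +
    ∑ α, ∑ β, christoffel g (γ t) (extChartAt 𝓘(ℝ, Euc (n + 1)) (γ t) (γ t)) k α β *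
      deriv (x α) t * deriv (x β) t

/-- `γ` restricted to the open set `J` of times is a light-like geodesic: its covariant acceleration
vanishes, and its velocity is a nonzero null vector. -/
structure IsLightlikeGeodesicOn (g : LorentzianMetric n M) (γ : ℝ → M) (J : Set ℝ) : Prop where
  contMDiffOn : ContMDiffOn 𝓘(ℝ, ℝ) 𝓘(ℝ, Euc (n + 1)) 2 γ J
  geodesic : ∀ t ∈ J, ∀ k, covAccel g γ t k = 0
  velocity_ne_zero : ∀ t ∈ J, mfderiv 𝓘(ℝ, ℝ) 𝓘(ℝ, Euc (n + 1)) γ t (1 : ℝ) ≠ 0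
  lightlike : ∀ t ∈ J, g.inner (γ t) (mfderiv 𝓘(ℝ, ℝ) 𝓘(ℝ, Euc (n + 1)) γ t (1 : ℝ))
    (mfderiv 𝓘(ℝ, ℝ) 𝓘(ℝ, Euc (n + 1)) γ t (1 : ℝ)) = 0

/-- The image `F(U)` contains a light-like geodesic segment through `F o` that consists of
degenerate light-like points: there is a continuous curve `c` of degenerate light-like points
in `U` with `c 0 = o` such that `F ∘ c` is a light-like geodesic. -/
def ContainsDegenerateLightlikeGeodesic (g : LorentzianMetric n M) (F : Euc n → M)
    (U : Set (Euc n)) (o : Euc n) : Prop :=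
  ∃ ε : ℝ, 0 < ε ∧ ∃ c : ℝ → Euc n, c 0 = o ∧ ContinuousOn c (Set.Ioo (-ε) ε) ∧
    (∀ t ∈ Set.Ioo (-ε) ε, c t ∈ U ∧ IsDegenerateLightlikePoint g F (c t)) ∧
    IsLightlikeGeodesicOn g (fun t ↦ F (c t)) (Set.Ioo (-ε) ε)

end

end LorentzHypersurface

/-! Work in the chart at `F o` and fix a constant vector e transversal to the hypersurface X at o.
Instead of the unit normal, which degenerates at light-like points, take the normal field ν = dX(ξ)
+ l e normalised by ⟨e, ν⟩ = 1. Its coefficients form a column of the inverse Gram matrix of the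
frame e, X_{u_1}, …, X_{u_n}, so they are C^2 across light-like points. Moreover l = ⟨ν, ν⟩, and B_F
is l times the nonvanishing Gram determinant, so degenerate light-like points are the points where l
and dl vanish.

Write II for the second fundamental form with respect to ν. Inverting a block gives s^{ij} = Q^{ij}
- ξ^i ξ^j / l, with Q a block of the inverse Gram matrix. If the trace of II is the restriction of a
C^1 function φ, then II(ξ, ξ) is l times a C^1 function. On the other hand dl(ξ) = -2 II(ξ, ξ) up to
terms divisible by l. Hence dl(ξ) = l ψ with ψ of class C^1 (`exists_fderiv_transversalPart_eq`).

Along a curve c' = p ξ(c) this is a linear equation for l. Its differential gives, once l = 0, a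
linear equation for dl. Both have zero initial value, so c consists of degenerate light-like points
(`eventually_degenerate_zero`). There dX(ξ) = ν is null and nonzero. Also dl(b) = -2 II(b, ξ) = 0
for all b, so D_ξ ν is orthogonal to all tangent vectors, i.e. proportional to ν. A suitable
equation for p makes the parameter affine (`exists_null_geodesic`).

In the class of case 1 the trace is φ up to the change of normal; for zero mean curvature it is 0,
once the chart used at each point has been replaced by the one at `F o`
(`trace_secondForm_eq_zero`). -/

namespace LorentzHypersurface

/-! ### Propagation of degenerate zeros, and the null geodesic, in a normed space. -/

section NullCurve

variable {E V : Type*} [NormedAddCommGroup E] [NormedSpace ℝ E]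
  [NormedAddCommGroup V] [NormedSpace ℝ V]

/-- A solution of a linear differential equation that vanishes at one time vanishes nearby. -/
theorem eventually_eq_zero_of_linear_ode {f : ℝ → E} {A : ℝ → E →L[ℝ] E} {t₀ : ℝ}
    (hA : ContinuousAt A t₀) (hf : ∀ᶠ t in 𝓝 t₀, HasDerivAt f (A t (f t)) t) (h0 : f t₀ = 0) :
    ∀ᶠ t in 𝓝 t₀, f t = 0 := by
  have hbd : ∀ᶠ t in 𝓝 t₀, ‖A t‖ < ‖A t₀‖ + 1 := hA.norm.eventually_lt_const (by simp)
  have := ODE_solution_unique_of_eventually (v := fun t x ↦ A t x) (s := fun _ ↦ Set.univ)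
    (K := ⟨‖A t₀‖ + 1, by positivity⟩) (f := f) (g := fun _ ↦ 0) (t₀ := t₀)
    (hbd.mono fun t ht ↦ ((A t).lipschitz.weaken (by exact_mod_cast ht.le)).lipschitzOnWith)
    (hf.mono fun t ht ↦ ⟨ht, trivial⟩)
    (Filter.Eventually.of_forall fun t ↦ ⟨by simpa using hasDerivAt_const t (0 : E), trivial⟩) h0
  exact this

/-- If `dl(ξ) = l ψ` holds where `l ≠ 0`, it holds everywhere. -/
theorem fderiv_apply_eq_of_ne_zero {l ψ : E → ℝ} {ξ : E → E} {o : E}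
    (hl : ContDiffAt ℝ 2 l o) (hξ : ContDiffAt ℝ 1 ξ o) (hψ : ContDiffAt ℝ 1 ψ o)
    (h : ∀ᶠ q in 𝓝 o, l q ≠ 0 → fderiv ℝ l q (ξ q) = l q * ψ q) :
    ∀ᶠ q in 𝓝 o, fderiv ℝ l q (ξ q) = l q * ψ q := by
  filter_upwards [hl.eventually (by simp), hξ.eventually (by simp), hψ.eventually (by simp),
    h.eventually_nhds] with q hlq hξq hψq hq
  -- Either q is a limit of points with l ≠ 0, and continuity applies, or l vanishes near q and both
  -- sides are zero.
  by_cases hfreq : ∃ᶠ x in 𝓝 q, l x ≠ 0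
  · have hc1 : ContinuousAt (fun x ↦ fderiv ℝ l x (ξ x)) q :=
      (hlq.fderiv_right (m := 1) (by norm_num)).continuousAt.clm_apply hξq.continuousAt
    have hc2 : ContinuousAt (fun x ↦ l x * ψ x) q := hlq.continuousAt.mul hψq.continuousAt
    by_contra hne
    have hne' := (hc1.sub hc2).eventually_ne (sub_ne_zero.2 hne)
    obtain ⟨x, hx, hx1, hx2⟩ := (hfreq.and_eventually (hq.and hne')).exists
    exact hx2 (sub_eq_zero.2 (hx1 hx))
  · have hz : l =ᶠ[𝓝 q] fun _ ↦ 0 := by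
      simpa [Filter.EventuallyEq] using hfreq
    rw [hz.fderiv_eq, hz.eq_of_nhds]
    simp

/-- If `dl(ξ) = l ψ`, then a degenerate zero of `l` propagates along the curves `c' = p ξ(c)`. -/
theorem eventually_degenerate_zero {l ψ : E → ℝ} {ξ : E → E} {o : E}
    (hl : ContDiffAt ℝ 2 l o) (hξ : ContDiffAt ℝ 1 ξ o) (hψ : ContDiffAt ℝ 1 ψ o)
    (h : ∀ᶠ q in 𝓝 o, fderiv ℝ l q (ξ q) = l q * ψ q)
    (hlo : l o = 0) (hdlo : fderiv ℝ l o = 0)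
    {c : ℝ → E} {p : ℝ → ℝ} (hc0 : c 0 = o) (hp : ContinuousAt p 0)
    (hc : ∀ᶠ t in 𝓝 0, HasDerivAt c (p t • ξ (c t)) t) :
    ∀ᶠ t in 𝓝 0, l (c t) = 0 ∧ fderiv ℝ l (c t) = 0 := by
  have hcc : ContinuousAt c 0 := hc.self_of_nhds.continuousAt
  have hct : Filter.Tendsto c (𝓝 0) (𝓝 o) := hc0 ▸ hcc
  have hψc : ContinuousAt (fun t ↦ ψ (c t)) 0 :=
    ContinuousAt.comp (g := ψ) (hc0 ▸ hψ.continuousAt) hcc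
  have hdξc : ContinuousAt (fun t ↦ fderiv ℝ ξ (c t)) 0 :=
    ContinuousAt.comp (g := fderiv ℝ ξ)
      (hc0 ▸ (hξ.fderiv_right (m := 0) (by norm_num)).continuousAt) hcc
  have h0 : ∀ᶠ t in 𝓝 0, l (c t) = 0 := by
    refine eventually_eq_zero_of_linear_ode
      (A := fun t ↦ (p t * ψ (c t)) • ContinuousLinearMap.id ℝ ℝ) ?_ ?_ (by rw [hc0, hlo])
    · exact (hp.mul hψc).smul continuousAt_const
    · filter_upwards [hc, hct.eventually h, hct.eventually (hl.eventually (by simp))]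
        with t ht1 ht2 ht3
      have := (ht3.differentiableAt two_ne_zero).hasFDerivAt.comp_hasDerivAt t ht1
      refine this.congr_deriv ?_
      simp [ht2]; ring
  have h1 : ∀ᶠ t in 𝓝 0, fderiv ℝ l (c t) = 0 := by
    -- Differentiating dl(ξ) = l ψ in a direction a, with d²l symmetric and l = 0 on the curve,
    -- gives d²l(ξ, a) = ψ dl(a) - dl(dξ(a)). Times p, this is a linear equation for dl along c.
    refine eventually_eq_zero_of_linear_ode (f := fun t ↦ fderiv ℝ l (c t))
      (A := fun t ↦ (p t * ψ (c t)) • ContinuousLinearMap.id ℝ (E →L[ℝ] ℝ) -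
        p t • (ContinuousLinearMap.compL ℝ E E ℝ).flip (fderiv ℝ ξ (c t))) ?_ ?_ (by rw [hc0, hdlo])
    · exact ((hp.mul hψc).smul continuousAt_const).sub
        (hp.smul (ContinuousAt.comp (g := (ContinuousLinearMap.compL ℝ E E ℝ).flip)
          (ContinuousLinearMap.continuous _).continuousAt hdξc))
    · filter_upwards [hc, h0, hct.eventually h.eventually_nhds,
        hct.eventually (hl.eventually (by simp)), hct.eventually (hξ.eventually (by simp)),
        hct.eventually (hψ.eventually (by simp))] with t ht1 ht0 ht2 hlt hξt hψt
      have hd : HasFDerivAt (fderiv ℝ l) (fderiv ℝ (fderiv ℝ l) (c t)) (c t) :=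
        ((hlt.fderiv_right (m := 1) (by norm_num)).differentiableAt one_ne_zero).hasFDerivAt
      have hsymm := hlt.isSymmSndFDerivAt (by simp)
      refine (hd.comp_hasDerivAt t ht1).congr_deriv ?_
      ext a
      have e1 := hd.clm_apply (hξt.differentiableAt one_ne_zero).hasFDerivAt
      have e2 := (hlt.differentiableAt two_ne_zero).hasFDerivAt.mul
        (hψt.differentiableAt one_ne_zero).hasFDerivAt
      have e3 := congrArg (· a) ((e1.congr_of_eventuallyEq
        (Filter.EventuallyEq.symm ht2)).unique e2)
      simp [ht0] at e3
      have e4 := hsymm a (ξ (c t))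
      simp
      rw [← e4]
      linear_combination p t * e3
  exact h0.and h1

/-- The derivative of the squared length of a normal field `ν = dX(ξ) + l e`, `⟨e, ν⟩ = 1`. -/
theorem fderiv_normal_sq {X : E → V} {G : V → V →L[ℝ] V →L[ℝ] ℝ} {e : V} {ξ : E → E} {l : E → ℝ}
    {q : E} (hX : ContDiffAt ℝ 2 X q) (hG : DifferentiableAt ℝ G (X q))
    (hsymm : ∀ a b, G (X q) a b = G (X q) b a)
    (hξ : DifferentiableAt ℝ ξ q) (hl : DifferentiableAt ℝ l q)
    (hν : ∀ᶠ x in 𝓝 q, ∀ a, G (X x) (fderiv ℝ X x a) (fderiv ℝ X x (ξ x) + l x • e) = 0)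
    (hνe : ∀ᶠ x in 𝓝 q, G (X x) e (fderiv ℝ X x (ξ x) + l x • e) = 1) (a : E) :
    DifferentiableAt ℝ (fun x ↦ fderiv ℝ X x (ξ x) + l x • e) q ∧
      (∀ b, G (X q) (fderiv ℝ (fun x ↦ fderiv ℝ X x (ξ x) + l x • e) q a) (fderiv ℝ X q b) =
        - G (X q) (fderiv ℝ (fderiv ℝ X) q a b) (fderiv ℝ X q (ξ q) + l q • e)
        - fderiv ℝ G (X q) (fderiv ℝ X q a) (fderiv ℝ X q b) (fderiv ℝ X q (ξ q) + l q • e)) ∧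
      G (X q) (fderiv ℝ (fun x ↦ fderiv ℝ X x (ξ x) + l x • e) q a) e =
        - fderiv ℝ G (X q) (fderiv ℝ X q a) e (fderiv ℝ X q (ξ q) + l q • e) ∧
      fderiv ℝ l q a = -2 * G (X q) (fderiv ℝ (fderiv ℝ X) q a (ξ q))
          (fderiv ℝ X q (ξ q) + l q • e)
        - fderiv ℝ G (X q) (fderiv ℝ X q a) (fderiv ℝ X q (ξ q) + l q • e)
          (fderiv ℝ X q (ξ q) + l q • e) := by
  set ν : E → V := fun x ↦ fderiv ℝ X x (ξ x) + l x • e with hνdef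
  have hνq : fderiv ℝ X q (ξ q) + l q • e = ν q := rfl
  have hdX : DifferentiableAt ℝ (fderiv ℝ X) q :=
    (hX.fderiv_right (m := 1) (by norm_num)).differentiableAt one_ne_zero
  have hνd : DifferentiableAt ℝ ν q :=
    (hdX.clm_apply hξ).add (hl.smul_const e)
  have hGX : HasFDerivAt (fun x ↦ G (X x)) ((fderiv ℝ G (X q)).comp (fderiv ℝ X q)) q :=
    HasFDerivAt.comp (g := G) q hG.hasFDerivAt (hX.differentiableAt two_ne_zero).hasFDerivAt
  have h1 : ∀ b, G (X q) (fderiv ℝ ν q a) (fderiv ℝ X q b) =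
        - G (X q) (fderiv ℝ (fderiv ℝ X) q a b) (ν q)
        - fderiv ℝ G (X q) (fderiv ℝ X q a) (fderiv ℝ X q b) (ν q) := by
    intro b
    have e1 := (hGX.clm_apply (hdX.hasFDerivAt.clm_apply
      (hasFDerivAt_const b q))).clm_apply hνd.hasFDerivAt
    have e2 := congrArg (· a) ((e1.congr_of_eventuallyEq (f₁ := fun _ ↦ (0 : ℝ))
      ((hν.mono fun x hx ↦ (hx b).symm))).unique (hasFDerivAt_const 0 q))
    simp at e2
    rw [hsymm]
    linear_combination e2
  have h2 : G (X q) (fderiv ℝ ν q a) e =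
        - fderiv ℝ G (X q) (fderiv ℝ X q a) e (ν q) := by
    have e1 := (hGX.clm_apply (hasFDerivAt_const e q)).clm_apply hνd.hasFDerivAt
    have e2 := congrArg (· a) ((e1.congr_of_eventuallyEq (f₁ := fun _ ↦ (1 : ℝ))
      ((hνe.mono fun x hx ↦ hx.symm))).unique (hasFDerivAt_const 1 q))
    simp at e2
    rw [hsymm]
    linear_combination e2
  refine ⟨hνd, h1, h2, ?_⟩
  -- Pairing dX(ξ) + l e with ν leaves l ⟨e, ν⟩ = l. In the derivative of ⟨ν, ν⟩ the field dν is
  -- paired only with dX(ξ) and e, so the derivatives of ξ and l disappear by the two formulas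
  -- above.
  have hlν : ∀ᶠ x in 𝓝 q, l x = G (X x) (ν x) (ν x) := by
    filter_upwards [hν, hνe] with x hx1 hx2
    have : G (X x) (ν x) (ν x) = G (X x) (fderiv ℝ X x (ξ x)) (ν x) + l x * G (X x) e (ν x) := by
      conv_lhs => rw [show G (X x) (ν x) = G (X x) (fderiv ℝ X x (ξ x) + l x • e) from rfl]
      simp
    rw [this, hx1, hx2]; ring
  have e1 := (hGX.clm_apply hνd.hasFDerivAt).clm_apply hνd.hasFDerivAt
  have e2 := congrArg (· a) (e1.congr_of_eventuallyEq hlν).fderiv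
  simp at e2
  have e3 : G (X q) (fderiv ℝ ν q a) (ν q) = G (X q) (fderiv ℝ ν q a) (fderiv ℝ X q (ξ q))
      + l q * G (X q) (fderiv ℝ ν q a) e := by
    conv_lhs => rw [← hνq]
    simp
  have e4 : fderiv ℝ G (X q) (fderiv ℝ X q a) (ν q) (ν q) =
      fderiv ℝ G (X q) (fderiv ℝ X q a) (fderiv ℝ X q (ξ q)) (ν q)
      + l q * fderiv ℝ G (X q) (fderiv ℝ X q a) e (ν q) := by
    conv_lhs =>
      rw [show fderiv ℝ G (X q) (fderiv ℝ X q a) (ν q) = fderiv ℝ G (X q) (fderiv ℝ X q a)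
        (fderiv ℝ X q (ξ q) + l q • e) from rfl]
    simp
  rw [hνq]
  rw [hsymm (ν q)] at e2
  rw [e2, e3, h1, h2]
  linear_combination 2 * e4

/-- The derivative of a field of symmetric bilinear forms is symmetric. -/
theorem fderiv_symm {G : V → V →L[ℝ] V →L[ℝ] ℝ} {y : V} (hG : DifferentiableAt ℝ G y)
    (hsymm : ∀ᶠ x in 𝓝 y, ∀ a b, G x a b = G x b a) (v a b : V) :
    fderiv ℝ G y v a b = fderiv ℝ G y v b a := by
  have e (a b : V) := (hG.hasFDerivAt.clm_apply (hasFDerivAt_const a y)).clm_apply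
    (hasFDerivAt_const b y)
  have := congrArg (· v) (((e a b).congr_of_eventuallyEq
    (f₁ := fun x ↦ G x b a) (hsymm.mono fun x hx ↦ hx b a)).unique (e b a))
  simpa using this

/-- Integral curves of a `C^1` vector field are `C^2`. -/
theorem contDiffAt_two_of_hasDerivAt {f : E → E} {α : ℝ → E} {t₀ : ℝ}
    (hf : ContDiffAt ℝ 1 f (α t₀)) (hα : ∀ᶠ t in 𝓝 t₀, HasDerivAt α (f (α t)) t) :
    ContDiffAt ℝ 2 α t₀ := by
  -- Bootstrap: α gains one derivative over α' = f ∘ α; applied twice, starting from continuity.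
  have hstep (n : ℕ) (h : ContDiffAt ℝ n (fun t ↦ f (α t)) t₀) : ContDiffAt ℝ (n + 1) α t₀ := by
    rw [contDiffAt_succ_iff_hasFDerivAt]
    refine ⟨fun t ↦ ContinuousLinearMap.toSpanSingleton ℝ (f (α t)), ⟨_, hα, fun t ht ↦ ?_⟩, ?_⟩
    · exact ht.hasFDerivAt
    · exact (ContinuousLinearMap.toSpanSingletonCLE (𝕜 := ℝ) (E := E)).contDiff.contDiffAt.comp t₀ h
  have h0 : ContDiffAt ℝ 0 α t₀ := contDiffAt_zero.2 ⟨_, hα, fun t ht ↦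
    (ht : HasDerivAt _ _ _).continuousAt.continuousWithinAt⟩
  have h1 : ContDiffAt ℝ 1 α t₀ := by
    simpa using hstep 0 (ContDiffAt.comp (g := f) t₀ (hf.of_le (by simp)) h0)
  have h2 := hstep 1 (ContDiffAt.comp (g := f) t₀ hf h1)
  norm_num at h2
  exact h2

set_option maxSynthPendingDepth 3 in
/-- If the squared length `l` of the normal field `ν = dX(ξ) + l e` satisfies `dl(ξ) = l ψ` where
`l ≠ 0`, then there is a null geodesic of `G` in the image of `X`, through every degenerate
zero of `l`, along which `l` and `dl` vanish. The geodesic equation is stated in lowered form. -/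
theorem exists_null_geodesic [CompleteSpace E]
    {X : E → V} {G : V → V →L[ℝ] V →L[ℝ] ℝ} {e : V} {ξ : E → E}
    {l ψ : E → ℝ} {o : E} (hX : ContDiffAt ℝ 3 X o) (hG : ContDiffAt ℝ 2 G (X o))
    (hsymm : ∀ᶠ y in 𝓝 (X o), ∀ a b, G y a b = G y b a)
    (hξ : ContDiffAt ℝ 2 ξ o) (hl : ContDiffAt ℝ 2 l o) (hψ : ContDiffAt ℝ 1 ψ o)
    (hν : ∀ᶠ x in 𝓝 o, ∀ a, G (X x) (fderiv ℝ X x a) (fderiv ℝ X x (ξ x) + l x • e) = 0)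
    (hνe : ∀ᶠ x in 𝓝 o, G (X x) e (fderiv ℝ X x (ξ x) + l x • e) = 1)
    (hspan : ∀ᶠ x in 𝓝 o, ∀ v, ∃ a, ∃ r : ℝ, v = fderiv ℝ X x a + r • e)
    (h : ∀ᶠ q in 𝓝 o, l q ≠ 0 → fderiv ℝ l q (ξ q) = l q * ψ q)
    (hlo : l o = 0) (hdlo : fderiv ℝ l o = 0) :
    ∃ c : ℝ → E, c 0 = o ∧ ContDiffAt ℝ 2 c 0 ∧ ∀ᶠ t in 𝓝 0, l (c t) = 0 ∧ fderiv ℝ l (c t) = 0 ∧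
      deriv (X ∘ c) t ≠ 0 ∧ G (X (c t)) (deriv (X ∘ c) t) (deriv (X ∘ c) t) = 0 ∧
      ∀ z, G (X (c t)) (deriv (deriv (X ∘ c)) t) z +
        (fderiv ℝ G (X (c t)) (deriv (X ∘ c) t) (deriv (X ∘ c) t) z -
        (1 / 2) * fderiv ℝ G (X (c t)) z (deriv (X ∘ c) t) (deriv (X ∘ c) t)) = 0 := by
  have hdX : ContDiffAt ℝ 2 (fderiv ℝ X) o := hX.fderiv_right (by norm_num)
  have hdG : ContDiffAt ℝ 1 (fderiv ℝ G) (X o) := hG.fderiv_right (by norm_num)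
  set ν : E → V := fun x ↦ fderiv ℝ X x (ξ x) + l x • e with hνdef
  have hνC : ContDiffAt ℝ 2 ν o := (hdX.clm_apply hξ).add (hl.smul contDiffAt_const)
  have hν1 : ContDiffAt ℝ 1 ν o := hνC.of_le (by norm_num)
  -- Where l = 0 one has ⟨D_ξ ν, e⟩ = -μ, so where also dl = 0 the covariant derivative D_ξ ν is -μ
  -- ν. The covariant acceleration of a curve with velocity p ν is then (p' - p² μ) ν, hence p' = p²
  -- μ below. The initial value p = 1 keeps the velocity nonzero for small times.
  set μ : E → ℝ := fun x ↦ (1 / 2) * fderiv ℝ G (X x) e (ν x) (ν x) with hμdef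
  have hμ : ContDiffAt ℝ 1 μ o :=
    contDiffAt_const.mul ((((ContDiffAt.comp (g := fderiv ℝ G) o hdG
      (hX.of_le (by norm_num))).clm_apply contDiffAt_const).clm_apply hν1).clm_apply hν1)
  have hfield : ContDiffAt ℝ 1 (fun x : E × ℝ ↦ (x.2 • ξ x.1, x.2 ^ 2 * μ x.1)) (o, 1) :=
    (contDiffAt_snd.smul (ContDiffAt.comp (g := ξ) (o, (1 : ℝ)) (hξ.of_le (by norm_num))
      contDiffAt_fst)).prodMk ((contDiffAt_snd.pow 2).mul
      (ContDiffAt.comp (g := μ) (o, (1 : ℝ)) hμ contDiffAt_fst))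
  obtain ⟨α, hα0, ε, hε, hα⟩ :=
    hfield.exists_forall_mem_closedBall_exists_eq_forall_mem_Ioo_hasDerivAt₀ 0
  have hαe : ∀ᶠ t in 𝓝 (0 : ℝ), HasDerivAt α
      ((α t).2 • ξ (α t).1, (α t).2 ^ 2 * μ (α t).1) t := by
    filter_upwards [Ioo_mem_nhds (show (0 : ℝ) - ε < 0 by linarith)
      (show (0 : ℝ) < 0 + ε by linarith)] with t ht using hα t ht
  have hc : ∀ᶠ t in 𝓝 (0 : ℝ), HasDerivAt (fun t ↦ (α t).1) ((α t).2 • ξ (α t).1) t :=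
    hαe.mono fun t ht ↦ ht.fst
  have hp : ∀ᶠ t in 𝓝 (0 : ℝ), HasDerivAt (fun t ↦ (α t).2) ((α t).2 ^ 2 * μ (α t).1) t :=
    hαe.mono fun t ht ↦ ht.snd
  have hc0 : (α 0).1 = o := by rw [hα0]
  have hp0 : (α 0).2 = 1 := by rw [hα0]
  set c : ℝ → E := fun t ↦ (α t).1
  set p : ℝ → ℝ := fun t ↦ (α t).2
  have hcc : ContinuousAt c 0 := hc.self_of_nhds.continuousAt
  have hpc : ContinuousAt p 0 := hp.self_of_nhds.continuousAt
  have hct : Filter.Tendsto c (𝓝 0) (𝓝 o) := hc0 ▸ hcc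
  have hξ1 : ContDiffAt ℝ 1 ξ o := hξ.of_le (by norm_num)
  have hdeg := eventually_degenerate_zero hl hξ1 hψ (fderiv_apply_eq_of_ne_zero hl hξ1 hψ h)
    hlo hdlo hc0 hpc hc
  have hXν : ∀ᶠ t in 𝓝 0, HasDerivAt (X ∘ c) (p t • ν (c t)) t := by
    filter_upwards [hc, hdeg, hct.eventually (hX.eventually (by simp))] with t ht h0 hXt
    refine ((hXt.differentiableAt (by norm_num)).hasFDerivAt.comp_hasDerivAt t ht).congr_deriv ?_
    simp [hνdef, h0.1]
    rfl
  refine ⟨c, hc0, ?_, ?_⟩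
  · have hα2 : ContDiffAt ℝ 2 α 0 := contDiffAt_two_of_hasDerivAt
      (f := fun x : E × ℝ ↦ (x.2 • ξ x.1, x.2 ^ 2 * μ x.1)) (by rw [hα0]; exact hfield) hαe
    exact hα2.fst
  have hXc : Filter.Tendsto (X ∘ c) (𝓝 0) (𝓝 (X o)) := hX.continuousAt.tendsto.comp hct
  filter_upwards [hc, hp, hdeg, hct.eventually (hX.eventually (by simp)),
    hXc.eventually (hG.eventually (by simp)), hXc.eventually hsymm.eventually_nhds,
    hct.eventually (hξ.eventually (by simp)), hct.eventually (hl.eventually (by simp)),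
    hct.eventually hν.eventually_nhds, hct.eventually hνe.eventually_nhds, hct.eventually hspan,
    hXν.eventually_nhds, hpc.eventually_ne (show p 0 ≠ 0 by simp [p, hp0])]
    with t hct hpt hdt hXt hGt hst hξt hlt hνt hνet hspt hXνt hp1
  have hl0 := hdt.1
  have hG1 : DifferentiableAt ℝ G (X (c t)) := hGt.differentiableAt two_ne_zero
  have key (a : E) := fderiv_normal_sq (hXt.of_le (by norm_num)) hG1 hst.self_of_nhds
    (hξt.differentiableAt two_ne_zero) (hlt.differentiableAt two_ne_zero) hνt hνet a
  have hνc : fderiv ℝ X (c t) (ξ (c t)) = ν (c t) := by simp [hνdef, hl0]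
  have hν0 := hνt.self_of_nhds
  have hνe0 := hνet.self_of_nhds
  have hXsymm := (hXt.of_le (m := 2) (by norm_num)).isSymmSndFDerivAt (by simp)
  have hdGs := fderiv_symm hG1 hst
  have hs : ∀ a b, G (X (c t)) a b = G (X (c t)) b a := hst.self_of_nhds
  have hνn := hν0 (ξ (c t))
  simp only [hl0, zero_smul, add_zero, hνc] at key hν0 hνe0 hνn
  have hd1 : deriv (X ∘ c) t = p t • ν (c t) := hXνt.self_of_nhds.deriv
  have hd2 : deriv (deriv (X ∘ c)) t =
      p t • fderiv ℝ ν (c t) (p t • ξ (c t)) + (p t ^ 2 * μ (c t)) • ν (c t) := by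
    have e1 : deriv (X ∘ c) =ᶠ[𝓝 t] fun s ↦ p s • ν (c s) := hXνt.mono fun s hs ↦ hs.deriv
    rw [e1.deriv_eq]
    exact (hpt.smul ((key 0).1.hasFDerivAt.comp_hasDerivAt t hct)).deriv
  refine ⟨hl0, hdt.2, ?_, ?_, fun z ↦ ?_⟩
  · rw [hd1]
    refine smul_ne_zero hp1 fun h0 ↦ ?_
    rw [h0] at hνe0
    simp at hνe0
  · rw [hd1]; simp [hνn]
  -- Test against z = dX(b) + r e. The tangential part is the formula for dl(b) = 0; the e part
  -- vanishes by the choice of μ.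
  · obtain ⟨b, r, rfl⟩ := hspt z
    obtain ⟨-, k1, k2, -⟩ := key (ξ (c t))
    obtain ⟨-, -, -, k3⟩ := key b
    have hb0 := hν0 b
    rw [hs] at hb0 hνe0
    have k1b := k1 b
    rw [hdt.2, hXsymm b] at k3
    rw [hνc] at k1b k2
    rw [hdGs _ _ (ν (c t))] at k1b k2
    change G _ (fderiv ℝ ν _ _) _ = _ at k1b k2
    rw [hd1, hd2]
    simp [hb0, hνe0, hμdef, k1b, k2]
    simp at k3
    linear_combination -(p t) ^ 2 / 2 * k3

end NullCurve

noncomputable section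

/-! ### Lowered Christoffel symbols under a change of coordinates. -/

section Koszul

variable {E V V' : Type*} [NormedAddCommGroup E] [NormedSpace ℝ E]
  [NormedAddCommGroup V] [NormedSpace ℝ V] [NormedAddCommGroup V'] [NormedSpace ℝ V']

/-- The Christoffel symbol of the first kind of a field of bilinear forms. -/
def christoffelLow (G : V → V →L[ℝ] V →L[ℝ] ℝ) (y a b z : V) : ℝ :=
  (1 / 2) * (fderiv ℝ G y a b z + fderiv ℝ G y b a z - fderiv ℝ G y z a b)

theorem fderiv_fderiv_comp {T : V → V'} {X : E → V} {q : E}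
    (hT : ContDiffAt ℝ 2 T (X q)) (hX : ContDiffAt ℝ 2 X q) (a b : E) :
    fderiv ℝ (fderiv ℝ (T ∘ X)) q a b =
      fderiv ℝ (fderiv ℝ T) (X q) (fderiv ℝ X q a) (fderiv ℝ X q b) +
        fderiv ℝ T (X q) (fderiv ℝ (fderiv ℝ X) q a b) := by
  have hdT : DifferentiableAt ℝ (fderiv ℝ T) (X q) :=
    (hT.fderiv_right (m := 1) (by norm_num)).differentiableAt one_ne_zero
  have hdX : DifferentiableAt ℝ (fderiv ℝ X) q :=
    (hX.fderiv_right (m := 1) (by norm_num)).differentiableAt one_ne_zero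
  have e0 : fderiv ℝ (T ∘ X) =ᶠ[𝓝 q] fun x ↦ (fderiv ℝ T (X x)).comp (fderiv ℝ X x) := by
    filter_upwards [hX.eventually (by simp),
      hX.continuousAt.eventually (hT.eventually (by simp))] with x hx1 hx2
    exact fderiv_comp x (hx2.differentiableAt two_ne_zero) (hx1.differentiableAt two_ne_zero)
  have e1 := (HasFDerivAt.comp (g := fderiv ℝ T) q hdT.hasFDerivAt
    (hX.differentiableAt two_ne_zero).hasFDerivAt).clm_comp hdX.hasFDerivAt
  have e2 : fderiv ℝ (fderiv ℝ (T ∘ X)) q = _ := (e1.congr_of_eventuallyEq e0).fderiv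
  rw [e2]
  simp [add_comm]

/-- The transformation law of the Christoffel symbols, for `G` the pull-back of `G'` by `T`. -/
theorem christoffelLow_pullback {G : V → V →L[ℝ] V →L[ℝ] ℝ} {G' : V' → V' →L[ℝ] V' →L[ℝ] ℝ}
    {T : V → V'} {y : V} (hT : ContDiffAt ℝ 2 T y) (hG : DifferentiableAt ℝ G y)
    (hG' : DifferentiableAt ℝ G' (T y)) (hsymm : ∀ a b, G' (T y) a b = G' (T y) b a)
    (h : ∀ᶠ x in 𝓝 y, ∀ a b, G x a b = G' (T x) (fderiv ℝ T x a) (fderiv ℝ T x b)) (a b z : V) :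
    christoffelLow G y a b z =
      G' (T y) (fderiv ℝ (fderiv ℝ T) y a b) (fderiv ℝ T y z) +
      christoffelLow G' (T y) (fderiv ℝ T y a) (fderiv ℝ T y b) (fderiv ℝ T y z) := by
  have hdT : DifferentiableAt ℝ (fderiv ℝ T) y :=
    (hT.fderiv_right (m := 1) (by norm_num)).differentiableAt one_ne_zero
  have hs := hT.isSymmSndFDerivAt (by simp)
  have hGT := HasFDerivAt.comp (g := G') y hG'.hasFDerivAt
    (hT.differentiableAt two_ne_zero).hasFDerivAt
  have key (a b z : V) : fderiv ℝ G y a b z =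
      fderiv ℝ G' (T y) (fderiv ℝ T y a) (fderiv ℝ T y b) (fderiv ℝ T y z) +
      G' (T y) (fderiv ℝ (fderiv ℝ T) y a b) (fderiv ℝ T y z) +
      G' (T y) (fderiv ℝ (fderiv ℝ T) y a z) (fderiv ℝ T y b) := by
    have e1 := (hGT.clm_apply (hdT.hasFDerivAt.clm_apply (hasFDerivAt_const b y))).clm_apply
      (hdT.hasFDerivAt.clm_apply (hasFDerivAt_const z y))
    have e2 := (hG.hasFDerivAt.clm_apply (hasFDerivAt_const b y)).clm_apply
      (hasFDerivAt_const z y)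
    have e3 := congrArg (· a) ((e1.congr_of_eventuallyEq (h.mono fun x hx ↦ hx b z)).unique e2)
    simp at e3
    rw [hsymm _ (fderiv ℝ T y b)]
    linear_combination -e3
  -- In the Koszul combination the terms with d²T(a, z) and d²T(b, z) cancel, and the two with
  -- d²T(a, b) add up.
  simp only [christoffelLow, key]
  rw [hs b a, hs z a, hs z b, hsymm _ (fderiv ℝ T y b)]
  ring

/-- The lowered second covariant derivative of a map does not depend on the coordinates. -/
theorem koszul_comp {G : V → V →L[ℝ] V →L[ℝ] ℝ} {G' : V' → V' →L[ℝ] V' →L[ℝ] ℝ}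
    {T : V → V'} {X : E → V} {q : E} (hX : ContDiffAt ℝ 2 X q)
    (hT : ContDiffAt ℝ 2 T (X q)) (hG : DifferentiableAt ℝ G (X q))
    (hG' : DifferentiableAt ℝ G' (T (X q)))
    (hsymm : ∀ a b, G' (T (X q)) a b = G' (T (X q)) b a)
    (h : ∀ᶠ x in 𝓝 (X q), ∀ a b, G x a b = G' (T x) (fderiv ℝ T x a) (fderiv ℝ T x b))
    (a b : E) (z : V) :
    G' (T (X q)) (fderiv ℝ (fderiv ℝ (T ∘ X)) q a b) (fderiv ℝ T (X q) z) +
      christoffelLow G' (T (X q)) (fderiv ℝ (T ∘ X) q a) (fderiv ℝ (T ∘ X) q b)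
        (fderiv ℝ T (X q) z) =
    G (X q) (fderiv ℝ (fderiv ℝ X) q a b) z +
      christoffelLow G (X q) (fderiv ℝ X q a) (fderiv ℝ X q b) z := by
  rw [fderiv_fderiv_comp hT hX, christoffelLow_pullback hT hG hG' hsymm h,
    h.self_of_nhds, fderiv_comp q (hT.differentiableAt two_ne_zero)
      (hX.differentiableAt two_ne_zero)]
  simp
  ring

end Koszul

/-! ### The metric and its Christoffel symbols in the charts of the manifold. -/

section Chart

variable {n : ℕ} {M : Type*} [TopologicalSpace M] [ChartedSpace (Euc (n + 1)) M]

/-- The preferred chart at `p`. -/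
abbrev cht (n : ℕ) {M : Type*} [TopologicalSpace M] [ChartedSpace (Euc (n + 1)) M] (p : M) : PartialEquiv M (Euc (n + 1)) := extChartAt 𝓘(ℝ, Euc (n + 1)) p

theorem isOpen_cht_target (p : M) : IsOpen (cht n p).target := isOpen_extChartAt_target p

theorem isOpen_cht_source (p : M) : IsOpen (cht n p).source := isOpen_extChartAt_source p

/-- The transition map between two charts. -/
def trans (n : ℕ) {M : Type*} [TopologicalSpace M] [ChartedSpace (Euc (n + 1)) M] (p p' : M) :
    Euc (n + 1) → Euc (n + 1) := cht n p' ∘ (cht n p).symm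

theorem eventually_trans (p p' : M) {y : Euc (n + 1)} (hy : y ∈ (cht n p).target)
    (hy' : (cht n p).symm y ∈ (cht n p').source) :
    ∀ᶠ x in 𝓝 y, x ∈ (cht n p).target ∧ (cht n p).symm x ∈ (cht n p').source := by
  have hc : ContinuousAt (cht n p).symm y := continuousAt_extChartAt_symm'' hy
  exact Filter.Eventually.and ((isOpen_cht_target p).mem_nhds hy) (hc ((isOpen_cht_source p').mem_nhds hy'))

variable [IsManifold 𝓘(ℝ, Euc (n + 1)) ∞ M]

/-- The derivative of the inverse of the preferred chart at `p`. -/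
def dsymm (p : M) (y : Euc (n + 1)) : Euc (n + 1) →L[ℝ] Euc (n + 1) :=
  mfderiv 𝓘(ℝ, Euc (n + 1)) 𝓘(ℝ, Euc (n + 1)) (cht n p).symm y

/-- The metric at `x` as a bilinear form on the model space. -/
def innerE (g : LorentzianMetric n M) (x : M) : Euc (n + 1) →L[ℝ] Euc (n + 1) →L[ℝ] ℝ := g.inner x

/-- The metric in the preferred chart at `p`, as a field of bilinear forms. -/
def gform (g : LorentzianMetric n M) (p : M) (y : Euc (n + 1)) :
    Euc (n + 1) →L[ℝ] Euc (n + 1) →L[ℝ] ℝ :=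
  (innerE g ((cht n p).symm y)).bilinearComp (dsymm p y) (dsymm p y)

theorem gform_apply (g : LorentzianMetric n M) (p : M) (y a b : Euc (n + 1)) :
    gform g p y a b = innerE g ((cht n p).symm y) (dsymm p y a) (dsymm p y b) := rfl

theorem gform_stdVec (g : LorentzianMetric n M) (p : M) (y : Euc (n + 1)) (α β : Fin (n + 1)) :
    gform g p y (stdVec α) (stdVec β) = metricCoeff g p y α β := rfl

theorem gform_symm (g : LorentzianMetric n M) (p : M) (y a b : Euc (n + 1)) :
    gform g p y a b = gform g p y b a := g.symm _ _ _

theorem eq_sum_stdVec {m : ℕ} (a : Euc m) : a = ∑ i, a i • stdVec i := by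
  have := (EuclideanSpace.basisFun (Fin m) ℝ).sum_repr a
  simpa [stdVec] using this.symm

theorem clm_eq_sum_stdVec {m : ℕ} {W : Type*} [NormedAddCommGroup W] [NormedSpace ℝ W]
    (f : Euc m →L[ℝ] W) (a : Euc m) : f a = ∑ i, a i • f (stdVec i) := by
  conv_lhs => rw [eq_sum_stdVec a]
  simp

theorem gform_eq_sum (g : LorentzianMetric n M) (p : M) (y a b : Euc (n + 1)) :
    gform g p y a b = ∑ α, ∑ β, metricCoeff g p y α β * a α * b β := by
  rw [clm_eq_sum_stdVec (gform g p y) a, _root_.sum_apply]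
  refine Finset.sum_congr rfl fun α _ ↦ ?_
  rw [_root_.smul_apply, clm_eq_sum_stdVec _ b, Finset.smul_sum]
  refine Finset.sum_congr rfl fun β _ ↦ ?_
  rw [gform_stdVec]
  simp only [smul_eq_mul]
  ring

theorem contDiffAt_gform (g : LorentzianMetric n M) (p : M) {y : Euc (n + 1)}
    (hy : y ∈ (cht n p).target) : ContDiffAt ℝ ∞ (gform g p) y := by
  refine ContDiffOn.contDiffAt (s := (cht n p).target) ?_ ((isOpen_cht_target p).mem_nhds hy)
  refine contDiffOn_clm_apply.2 fun a ↦ contDiffOn_clm_apply.2 fun b ↦ ?_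
  simp only [gform_eq_sum]
  exact ContDiffOn.sum fun α _ ↦ ContDiffOn.sum fun β _ ↦
    ((g.smooth p α β).mul contDiffOn_const).mul contDiffOn_const

theorem mdifferentiableAt_cht_symm (p : M) {y : Euc (n + 1)} (hy : y ∈ (cht n p).target) :
    MDifferentiableAt 𝓘(ℝ, Euc (n + 1)) 𝓘(ℝ, Euc (n + 1)) (cht n p).symm y :=
  ((contMDiffOn_extChartAt_symm (I := 𝓘(ℝ, Euc (n + 1))) (n := ∞) p).contMDiffAt
    ((isOpen_cht_target p).mem_nhds hy)).mdifferentiableAt (by simp)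

theorem contMDiffAt_cht (p : M) {x : M} (hx : x ∈ (cht n p).source) :
    ContMDiffAt 𝓘(ℝ, Euc (n + 1)) 𝓘(ℝ, Euc (n + 1)) ∞ (cht n p) x :=
  contMDiffAt_extChartAt' (by simpa using hx)

theorem dsymm_injective (p : M) {y : Euc (n + 1)} (hy : y ∈ (cht n p).target) :
    Function.Injective (dsymm p y) := by
  have h1 := mdifferentiableAt_cht_symm p hy
  have h2 : MDifferentiableAt 𝓘(ℝ, Euc (n + 1)) 𝓘(ℝ, Euc (n + 1)) (cht n p) ((cht n p).symm y) :=
    (contMDiffAt_cht p ((cht n p).map_target hy)).mdifferentiableAt (by simp)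
  have h3 := mfderiv_comp y h2 h1
  have h4 : (cht n p) ∘ (cht n p).symm =ᶠ[𝓝 y] id := by
    filter_upwards [(isOpen_cht_target p).mem_nhds hy] with x hx using (cht n p).right_inv hx
  rw [h4.mfderiv_eq, mfderiv_id] at h3
  intro a b hab
  have ha := DFunLike.congr_fun h3 a
  have hb := DFunLike.congr_fun h3 b
  have hab' : mfderiv 𝓘(ℝ, Euc (n + 1)) 𝓘(ℝ, Euc (n + 1)) (cht n p).symm y a =
    mfderiv 𝓘(ℝ, Euc (n + 1)) 𝓘(ℝ, Euc (n + 1)) (cht n p).symm y b := hab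
  exact (ha.trans (congrArg (mfderiv 𝓘(ℝ, Euc (n + 1)) 𝓘(ℝ, Euc (n + 1)) (cht n p)
    ((cht n p).symm y)) hab')).trans hb.symm

theorem inner_nondegenerate (g : LorentzianMetric n M) (p : M)
    (v : Euc (n + 1)) (h : ∀ w, innerE g p v w = 0) : v = 0 := by
  obtain ⟨e, he⟩ := g.signature p
  have hv := e.sum_repr v
  have hc (j : Fin (n + 1)) : e.repr v j = 0 := by
    have : g.inner p (∑ i, e.repr v i • e i) (e j) = 0 := by rw [hv]; exact h (e j)
    simp only [map_sum, map_smul, _root_.sum_apply, _root_.smul_apply,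
      he, smul_eq_mul] at this
    by_cases hj : j = 0 <;> simpa [hj] using this
  rw [← hv]
  simp only [hc, zero_smul, Finset.sum_const_zero]
  rfl

theorem dsymm_surjective (p : M) {y : Euc (n + 1)} (hy : y ∈ (cht n p).target) :
    Function.Surjective (dsymm p y) :=
  LinearMap.injective_iff_surjective (f := (dsymm p y).toLinearMap).1
    (dsymm_injective p hy)

theorem gform_nondegenerate (g : LorentzianMetric n M) (p : M) {y : Euc (n + 1)}
    (hy : y ∈ (cht n p).target) {a : Euc (n + 1)} (h : ∀ b, gform g p y a b = 0) : a = 0 := by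
  have : dsymm p y a = 0 := inner_nondegenerate g _ _ fun w ↦ by
    obtain ⟨b, rfl⟩ := dsymm_surjective p hy w
    exact h b
  exact dsymm_injective p hy (by rw [this, map_zero])

/-- This allows vector identities, such as the transformation law of second derivatives and the
geodesic equation, to be checked in lowered form, without inverting the metric. -/
theorem gform_ext (g : LorentzianMetric n M) (p : M) {y : Euc (n + 1)}
    (hy : y ∈ (cht n p).target) {a b : Euc (n + 1)} (h : ∀ z, gform g p y a z = gform g p y b z) :
    a = b := by
  refine sub_eq_zero.1 (gform_nondegenerate g p hy fun z ↦ ?_)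
  simp [h]

theorem contDiffAt_trans (p p' : M) {y : Euc (n + 1)} (hy : y ∈ (cht n p).target)
    (hy' : (cht n p).symm y ∈ (cht n p').source) : ContDiffAt ℝ ∞ (trans n p p') y := by
  rw [← contMDiffAt_iff_contDiffAt]
  exact (contMDiffAt_cht p' hy').comp y
    ((contMDiffOn_extChartAt_symm p).contMDiffAt ((isOpen_cht_target p).mem_nhds hy))

theorem dsymm_trans (p p' : M) {y : Euc (n + 1)} (hy : y ∈ (cht n p).target)
    (hy' : (cht n p).symm y ∈ (cht n p').source) (a : Euc (n + 1)) :
    dsymm p y a = dsymm p' (trans n p p' y) (fderiv ℝ (trans n p p') y a) := by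
  have h1 : (cht n p).symm =ᶠ[𝓝 y] (cht n p').symm ∘ trans n p p' := by
    filter_upwards [eventually_trans p p' hy hy'] with x hx
    exact ((cht n p').left_inv hx.2).symm
  have h2 : MDifferentiableAt 𝓘(ℝ, Euc (n + 1)) 𝓘(ℝ, Euc (n + 1)) (trans n p p') y :=
    ((contDiffAt_trans p p' hy hy').differentiableAt (by simp)).mdifferentiableAt
  have h3 : trans n p p' y ∈ (cht n p').target := (cht n p').map_source hy'
  have h4 := mfderiv_comp y (mdifferentiableAt_cht_symm p' h3) h2
  have h5 : dsymm p y a = mfderiv 𝓘(ℝ, Euc (n + 1)) 𝓘(ℝ, Euc (n + 1))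
    ((cht n p').symm ∘ trans n p p') y a := by
    unfold dsymm
    rw [h1.mfderiv_eq]
    rfl
  refine h5.trans ?_
  rw [h4, mfderiv_eq_fderiv]
  rfl

theorem gform_trans (g : LorentzianMetric n M) (p p' : M) {y : Euc (n + 1)}
    (hy : y ∈ (cht n p).target) (hy' : (cht n p).symm y ∈ (cht n p').source) (a b : Euc (n + 1)) :
    gform g p y a b = gform g p' (trans n p p' y) (fderiv ℝ (trans n p p') y a)
      (fderiv ℝ (trans n p p') y b) := by
  rw [gform_apply, gform_apply]
  rw [dsymm_trans p p' hy hy' a, dsymm_trans p p' hy hy' b]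
  have : (cht n p').symm (trans n p p' y) = (cht n p).symm y := (cht n p').left_inv hy'
  rw [this]

/-- The kernel of the differential lies in the radical of the pulled-back metric, which is
nondegenerate; in equal dimensions injectivity suffices. -/
theorem fderiv_trans_surjective (g : LorentzianMetric n M) (p p' : M) {y : Euc (n + 1)}
    (hy : y ∈ (cht n p).target) (hy' : (cht n p).symm y ∈ (cht n p').source) :
    Function.Surjective (fderiv ℝ (trans n p p') y) := by
  refine LinearMap.injective_iff_surjective
    (f := (fderiv ℝ (trans n p p') y : Euc (n + 1) →ₗ[ℝ] Euc (n + 1))).1 ?_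
  refine (injective_iff_map_eq_zero _).2 fun a ha ↦ gform_nondegenerate g p hy fun b ↦ ?_
  have ha' : fderiv ℝ (trans n p p') y a = 0 := ha
  rw [gform_trans g p p' hy hy', ha']
  simp

theorem metricCoeff_isUnit_det (g : LorentzianMetric n M) (p : M) {y : Euc (n + 1)}
    (hy : y ∈ (cht n p).target) : IsUnit (metricCoeff g p y).det := by
  rw [isUnit_iff_ne_zero]
  intro h0
  obtain ⟨v, hv, h⟩ := Matrix.exists_vecMul_eq_zero_iff.2 h0
  refine hv ?_
  have : WithLp.toLp 2 v = (0 : Euc (n + 1)) := gform_nondegenerate g p hy fun b ↦ by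
    rw [gform_eq_sum, Finset.sum_comm]
    refine Finset.sum_eq_zero fun β _ ↦ ?_
    have := congrFun h β
    simp [Matrix.vecMul, dotProduct] at this
    rw [← Finset.sum_mul]
    simp [mul_comm (metricCoeff g p y _ _), this]
  simpa using this

/-- The Christoffel symbols of the second kind in the preferred chart, as a vector. -/
def chr (g : LorentzianMetric n M) (p : M) (y a b : Euc (n + 1)) : Euc (n + 1) :=
  WithLp.toLp 2 fun k ↦ ∑ α, ∑ β, christoffel g p y k α β * a α * b β

theorem pd_metricCoeff (g : LorentzianMetric n M) (p : M) {y : Euc (n + 1)}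
    (hy : y ∈ (cht n p).target) (α β l : Fin (n + 1)) :
    pd α (fun z ↦ metricCoeff g p z β l) y =
      fderiv ℝ (gform g p) y (stdVec α) (stdVec β) (stdVec l) := by
  have hd := ((contDiffAt_gform g p hy).differentiableAt (by simp)).hasFDerivAt
  have := ((hd.clm_apply (hasFDerivAt_const (stdVec β : Euc (n + 1)) y)).clm_apply
    (hasFDerivAt_const (stdVec l : Euc (n + 1)) y)).fderiv
  simp only [← gform_stdVec, pd]
  rw [this]
  simp

/-- This links the coordinate formula with the inverse matrix to the Koszul expression: on basis
vectors the metric matrix cancels its inverse, and both sides are trilinear. -/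
theorem gform_chr (g : LorentzianMetric n M) (p : M) {y : Euc (n + 1)}
    (hy : y ∈ (cht n p).target) (a b z : Euc (n + 1)) :
    gform g p y (chr g p y a b) z = christoffelLow (gform g p) y a b z := by
  have hl (α β m : Fin (n + 1)) : ∑ k, metricCoeff g p y k m * christoffel g p y k α β =
      christoffelLow (gform g p) y (stdVec α) (stdVec β) (stdVec m) := by
    have hsym (k m : Fin (n + 1)) : metricCoeff g p y k m = metricCoeff g p y m k :=
      gform_symm g p y _ _
    have hinv : metricCoeff g p y * (metricCoeff g p y)⁻¹ = 1 :=
      Matrix.mul_nonsing_inv _ (metricCoeff_isUnit_det g p hy)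
    set c : Fin (n + 1) → ℝ := fun l ↦ pd α (fun z ↦ metricCoeff g p z β l) y +
      pd β (fun z ↦ metricCoeff g p z α l) y - pd l (fun z ↦ metricCoeff g p z α β) y with hc
    have h1 : christoffelLow (gform g p) y (stdVec α) (stdVec β) (stdVec m) = (1 / 2) * c m := by
      simp only [hc, pd_metricCoeff g p hy, christoffelLow]
    have h2 : ∑ k, metricCoeff g p y k m * christoffel g p y k α β =
        (1 / 2) * ((metricCoeff g p y).mulVec ((metricCoeff g p y)⁻¹.mulVec c)) m := by
      simp only [Matrix.mulVec, dotProduct, christoffel, Finset.mul_sum]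
      refine Finset.sum_congr rfl fun k _ ↦ Finset.sum_congr rfl fun l _ ↦ ?_
      rw [hsym k m]
      ring
    rw [h1, h2, Matrix.mulVec_mulVec, hinv, Matrix.one_mulVec]
  have hL : christoffelLow (gform g p) y a b z = ∑ α, ∑ β, ∑ m, a α * b β * z m *
      christoffelLow (gform g p) y (stdVec α) (stdVec β) (stdVec m) := by
    have h3 (u v w : Euc (n + 1)) : fderiv ℝ (gform g p) y u v w = ∑ α, ∑ β, ∑ m,
        u α * v β * w m * fderiv ℝ (gform g p) y (stdVec α) (stdVec β) (stdVec m) := by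
      rw [clm_eq_sum_stdVec (fderiv ℝ (gform g p) y) u]
      simp only [_root_.sum_apply, _root_.smul_apply]
      refine Finset.sum_congr rfl fun α _ ↦ ?_
      rw [clm_eq_sum_stdVec _ v]
      simp only [_root_.sum_apply, _root_.smul_apply, Finset.smul_sum]
      refine Finset.sum_congr rfl fun β _ ↦ ?_
      rw [clm_eq_sum_stdVec _ w]
      simp only [Finset.mul_sum, smul_eq_mul]
      refine Finset.sum_congr rfl fun β _ ↦ by ring
    unfold christoffelLow
    rw [h3 a b z, h3 b a z, h3 z a b]
    have s1 : ∑ α, ∑ β, ∑ m, b α * a β * z m *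
        fderiv ℝ (gform g p) y (stdVec α) (stdVec β) (stdVec m) = ∑ α, ∑ β, ∑ m, b β * a α * z m *
        fderiv ℝ (gform g p) y (stdVec β) (stdVec α) (stdVec m) := Finset.sum_comm
    have s2 : ∑ α, ∑ β, ∑ m, z α * a β * b m *
        fderiv ℝ (gform g p) y (stdVec α) (stdVec β) (stdVec m) = ∑ α, ∑ β, ∑ m, z m * a α * b β *
        fderiv ℝ (gform g p) y (stdVec m) (stdVec α) (stdVec β) := by
      rw [Finset.sum_comm]
      exact Finset.sum_congr rfl fun _ _ ↦ Finset.sum_comm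
    rw [s1, s2]
    simp only [← Finset.sum_add_distrib, ← Finset.sum_sub_distrib, Finset.mul_sum]
    refine Finset.sum_congr rfl fun α _ ↦ Finset.sum_congr rfl fun β _ ↦
      Finset.sum_congr rfl fun m _ ↦ by ring
  rw [hL, gform_eq_sum]
  simp only [chr, ← hl, Finset.mul_sum, Finset.sum_mul]
  rw [Finset.sum_comm]
  calc _ = ∑ m, ∑ α, ∑ β, ∑ k,
        metricCoeff g p y k m * (christoffel g p y k α β * a α * b β) * z m := by
        refine Finset.sum_congr rfl fun m _ ↦ ?_
        rw [Finset.sum_comm]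
        exact Finset.sum_congr rfl fun _ _ ↦ Finset.sum_comm
    _ = _ := by
        rw [Finset.sum_comm]
        refine Finset.sum_congr rfl fun α _ ↦ ?_
        rw [Finset.sum_comm]
        exact Finset.sum_congr rfl fun β _ ↦ Finset.sum_congr rfl fun m _ ↦
          Finset.sum_congr rfl fun k _ ↦ by ring

/-- The second covariant derivative of a map in the preferred chart at `p`. -/
def covHess {E : Type*} [NormedAddCommGroup E] [NormedSpace ℝ E] (g : LorentzianMetric n M)
    (p : M) (X : E → Euc (n + 1)) (q a b : E) : Euc (n + 1) :=
  fderiv ℝ (fderiv ℝ X) q a b + chr g p (X q) (fderiv ℝ X q a) (fderiv ℝ X q b)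

/-- By nondegeneracy it is enough to pair with an arbitrary vector. Every vector in the new chart is
the image of some z, and then `koszul_comp` applies. -/
theorem covHess_trans {E : Type*} [NormedAddCommGroup E] [NormedSpace ℝ E]
    (g : LorentzianMetric n M) (p p' : M) {X : E → Euc (n + 1)} {q : E}
    (hX : ContDiffAt ℝ 2 X q) (hy : X q ∈ (cht n p).target)
    (hy' : (cht n p).symm (X q) ∈ (cht n p').source) (a b : E) :
    covHess g p' (trans n p p' ∘ X) q a b =
      fderiv ℝ (trans n p p') (X q) (covHess g p X q a b) := by
  have hy2 : trans n p p' (X q) ∈ (cht n p').target := (cht n p').map_source hy'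
  refine gform_ext g p' hy2 fun w ↦ ?_
  obtain ⟨z, rfl⟩ := fderiv_trans_surjective g p p' hy hy' w
  rw [← gform_trans g p p' hy hy']
  have hT := contDiffAt_trans p p' hy hy'
  have := koszul_comp (G := gform g p) (G' := gform g p') (T := trans n p p') hX
    (hT.of_le (WithTop.coe_le_coe.2 le_top))
    ((contDiffAt_gform g p hy).differentiableAt (by simp))
    ((contDiffAt_gform g p' hy2).differentiableAt (by simp)) (gform_symm g p' _)
    ((eventually_trans p p' hy hy').mono fun x hx ↦ gform_trans g p p' hx.1 hx.2) a b z
  simp only [covHess, map_add, _root_.add_apply, gform_chr g p hy]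
  rw [← this]
  congr 1
  exact gform_chr g p' hy2 _ _ _

end Chart

end

noncomputable section

/-! ### Smoothness of inverses, block inversion, and the determinant as a volume. -/

section Matrices

variable {E ι : Type*} [NormedAddCommGroup E] [NormedSpace ℝ E] [Fintype ι] [DecidableEq ι]

theorem contDiffAt_det {k : WithTop ℕ∞} {A : E → Matrix ι ι ℝ} {q : E}
    (h : ∀ i j, ContDiffAt ℝ k (fun x ↦ A x i j) q) : ContDiffAt ℝ k (fun x ↦ (A x).det) q := by
  simp only [Matrix.det_apply']
  exact ContDiffAt.sum fun σ _ ↦ contDiffAt_const.mul (contDiffAt_prod fun i _ ↦ h _ _)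

theorem contDiffAt_inv_apply {k : WithTop ℕ∞} {A : E → Matrix ι ι ℝ} {q : E}
    (h : ∀ i j, ContDiffAt ℝ k (fun x ↦ A x i j) q) (h0 : (A q).det ≠ 0) (i j : ι) :
    ContDiffAt ℝ k (fun x ↦ (A x)⁻¹ i j) q := by
  simp only [Matrix.inv_def, Ring.inverse_eq_inv', Matrix.smul_apply, Matrix.adjugate_apply,
    smul_eq_mul]
  refine ((contDiffAt_det h).inv h0).mul (contDiffAt_det fun a b ↦ ?_)
  by_cases hab : a = j
  · subst hab
    simpa using contDiffAt_const
  · simpa [Matrix.updateRow_ne hab] using h a b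

/-- The cofactor formula for the corner entry of the inverse of a matrix. -/
theorem det_submatrix_succ {n : ℕ} {A : Matrix (Fin (n + 1)) (Fin (n + 1)) ℝ} (h : A.det ≠ 0) :
    (A.submatrix Fin.succ Fin.succ).det = A⁻¹ 0 0 * A.det := by
  rw [Matrix.inv_def, Matrix.smul_apply, Matrix.adjugate_fin_succ_eq_det_submatrix]
  simp
  field_simp

/-- The inverse of a principal block in terms of the inverse of the full matrix. -/
theorem inv_submatrix_succ {n : ℕ} {A : Matrix (Fin (n + 1)) (Fin (n + 1)) ℝ} (h : A.det ≠ 0)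
    (hs : A.transpose = A) (h0 : A⁻¹ 0 0 ≠ 0) (i j : Fin n) :
    (A.submatrix Fin.succ Fin.succ)⁻¹ i j =
      A⁻¹ i.succ j.succ - A⁻¹ i.succ 0 * A⁻¹ j.succ 0 / A⁻¹ 0 0 := by
  have hPs : (A⁻¹).transpose = A⁻¹ := by rw [Matrix.transpose_nonsing_inv, hs]
  have hP (i j) : A⁻¹ i j = A⁻¹ j i := congrFun (congrFun hPs j) i
  have hmul : A * A⁻¹ = 1 := Matrix.mul_nonsing_inv _ (isUnit_iff_ne_zero.2 h)
  have key : (A.submatrix Fin.succ Fin.succ)⁻¹ = Matrix.of fun i j : Fin n ↦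
      A⁻¹ i.succ j.succ - A⁻¹ i.succ 0 * A⁻¹ j.succ 0 / A⁻¹ 0 0 := by
    refine Matrix.inv_eq_right_inv ?_
    ext i k
    -- Columns k + 1 and 0 of A A⁻¹ = 1, both in row i + 1; eliminating the entry of A in column 0
    -- gives the Schur complement.
    have e1 := congrFun (congrFun hmul i.succ) k.succ
    have e2 := congrFun (congrFun hmul i.succ) 0
    rw [Matrix.mul_apply, Fin.sum_univ_succ] at e1 e2
    simp [Matrix.one_apply] at e1 e2
    simp only [Matrix.mul_apply, Matrix.submatrix_apply, Matrix.of_apply, mul_sub,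
      Finset.sum_sub_distrib, Matrix.one_apply]
    have e3 : ∑ x : Fin n, A i.succ x.succ * (A⁻¹ x.succ 0 * A⁻¹ k.succ 0 / A⁻¹ 0 0) =
        (∑ x : Fin n, A i.succ x.succ * A⁻¹ x.succ 0) * (A⁻¹ k.succ 0 / A⁻¹ 0 0) := by
      rw [Finset.sum_mul]
      exact Finset.sum_congr rfl fun _ _ ↦ by ring
    rw [e3, ← e1, hP 0 k.succ, eq_neg_of_add_eq_zero_right e2]
    field_simp
    ring
  rw [key, Matrix.of_apply]

/-- The determinant as a linear function of its first row. -/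
def volLin {n : ℕ} (A : Fin n → Fin (n + 1) → ℝ) : (Fin (n + 1) → ℝ) →ₗ[ℝ] ℝ :=
  (Matrix.detRowAlternating (R := ℝ) (n := Fin (n + 1))).toMultilinearMap.toLinearMap
    (Matrix.vecCons 0 A) 0

theorem volLin_apply {n : ℕ} (A : Fin n → Fin (n + 1) → ℝ) (v : Fin (n + 1) → ℝ) :
    volLin A v = (Matrix.of (Matrix.vecCons v A)).det := by
  have : Function.update (Matrix.vecCons 0 A) 0 v = Matrix.vecCons v A := Fin.update_cons_zero _ _ _
  simp only [volLin, MultilinearMap.toLinearMap_apply, this]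
  rfl

/-- For tangent vectors in place of the rows, the vanishing of a normal component becomes tangency,
a condition that does not refer to the volume form or the orientation of a chart. -/
theorem volLin_eq_zero_iff {n : ℕ} {A : Fin n → Fin (n + 1) → ℝ} (hA : LinearIndependent ℝ A)
    (v : Fin (n + 1) → ℝ) : volLin A v = 0 ↔ v ∈ Submodule.span ℝ (Set.range A) := by
  have h1 := Matrix.linearIndependent_rows_iff_isUnit (A := Matrix.of (Matrix.vecCons v A))
  rw [Matrix.isUnit_iff_isUnit_det, isUnit_iff_ne_zero, ← volLin_apply] at h1
  have h2 : LinearIndependent ℝ (Fin.cons v A : Fin (n + 1) → Fin (n + 1) → ℝ) ↔ _ :=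
    linearIndependent_finCons
  have h3 : (Matrix.of (Matrix.vecCons v A)).row = Fin.cons v A := rfl
  rw [h3, h2] at h1
  by_contra hne
  tauto

end Matrices

/-! ### The geometric quantities of the hypersurface in coordinates. -/

section Bridge

variable {n : ℕ} {M : Type*} [TopologicalSpace M] [ChartedSpace (Euc (n + 1)) M]

variable {E : Type*} [NormedAddCommGroup E] [NormedSpace ℝ E]

theorem fderiv_coord {m : ℕ} {X : E → Euc m} {q : E} (hX : DifferentiableAt ℝ X q) (k : Fin m)
    (v : E) : fderiv ℝ (fun x ↦ X x k) q v = fderiv ℝ X q v k := by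
  have := ((EuclideanSpace.proj (𝕜 := ℝ) k).hasFDerivAt.comp q hX.hasFDerivAt).fderiv
  exact congrArg (· v) this

theorem pd_coord (p : M) {F : Euc n → M} {q : Euc n}
    (hX : DifferentiableAt ℝ (cht n p ∘ F) q) (i : Fin n) (k : Fin (n + 1)) :
    pd i (coord p F k) q = fderiv ℝ (cht n p ∘ F) q (stdVec i) k :=
  fderiv_coord hX k _

variable [IsManifold 𝓘(ℝ, Euc (n + 1)) ∞ M]

theorem contDiffAt_cht_comp {k : ℕ∞} (p : M) {F : E → M} {q : E}
    (hF : ContMDiffAt 𝓘(ℝ, E) 𝓘(ℝ, Euc (n + 1)) k F q) (hq : F q ∈ (cht n p).source) :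
    ContDiffAt ℝ k (cht n p ∘ F) q := by
  rw [← contMDiffAt_iff_contDiffAt]
  exact ((contMDiffAt_cht p hq).of_le (WithTop.coe_le_coe.2 le_top)).comp q hF

theorem mfderiv_eq_dsymm (p : M) {F : E → M} {q : E}
    (hF : ContMDiffAt 𝓘(ℝ, E) 𝓘(ℝ, Euc (n + 1)) 1 F q) (hq : F q ∈ (cht n p).source) (v : E) :
    (mfderiv 𝓘(ℝ, E) 𝓘(ℝ, Euc (n + 1)) F q v : Euc (n + 1)) =
      dsymm p (cht n p (F q)) (fderiv ℝ (cht n p ∘ F) q v) := by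
  have h1 : F =ᶠ[𝓝 q] (cht n p).symm ∘ (cht n p ∘ F) := by
    filter_upwards [hF.continuousAt ((isOpen_cht_source p).mem_nhds hq)] with x hx
    exact ((cht n p).left_inv hx).symm
  have h2 : MDifferentiableAt 𝓘(ℝ, E) 𝓘(ℝ, Euc (n + 1)) (cht n p ∘ F) q :=
    ((contDiffAt_cht_comp (k := 1) p hF hq).differentiableAt one_ne_zero).mdifferentiableAt
  have h3 := mfderiv_comp q (mdifferentiableAt_cht_symm p ((cht n p).map_source hq)) h2
  have h4 : (mfderiv 𝓘(ℝ, E) 𝓘(ℝ, Euc (n + 1)) F q v : Euc (n + 1)) =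
      mfderiv 𝓘(ℝ, E) 𝓘(ℝ, Euc (n + 1)) ((cht n p).symm ∘ (cht n p ∘ F)) q v := by
    rw [h1.mfderiv_eq]
    rfl
  refine h4.trans ?_
  rw [h3, mfderiv_eq_fderiv]
  rfl

theorem inner_mfderiv (g : LorentzianMetric n M) (p : M) {F : E → M} {q : E}
    (hF : ContMDiffAt 𝓘(ℝ, E) 𝓘(ℝ, Euc (n + 1)) 1 F q) (hq : F q ∈ (cht n p).source) (v w : E) :
    g.inner (F q) (mfderiv 𝓘(ℝ, E) 𝓘(ℝ, Euc (n + 1)) F q v)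
      (mfderiv 𝓘(ℝ, E) 𝓘(ℝ, Euc (n + 1)) F q w) =
    gform g p (cht n p (F q)) (fderiv ℝ (cht n p ∘ F) q v) (fderiv ℝ (cht n p ∘ F) q w) := by
  rw [gform_apply, ← mfderiv_eq_dsymm p hF hq v, ← mfderiv_eq_dsymm p hF hq w,
    (cht n p).left_inv hq]
  rfl

theorem covDeriv_eq (g : LorentzianMetric n M) (p : M) {F : Euc n → M} {q : Euc n}
    (hX : ContDiffAt ℝ 2 (cht n p ∘ F) q) (i j : Fin n) (k : Fin (n + 1)) :
    covDeriv g p F q i j k = covHess g p (cht n p ∘ F) q (stdVec i) (stdVec j) k := by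
  have hd := hX.differentiableAt two_ne_zero
  have h1 : pd j (coord p F k) =ᶠ[𝓝 q]
      fun x ↦ (fderiv ℝ (cht n p ∘ F) x (stdVec j) : Euc (n + 1)) k := by
    filter_upwards [hX.eventually (by simp)] with x hx
    exact pd_coord p (hx.differentiableAt two_ne_zero) j k
  have hdd : DifferentiableAt ℝ (fderiv ℝ (cht n p ∘ F)) q :=
    (hX.fderiv_right (m := 1) (by norm_num)).differentiableAt one_ne_zero
  have h2 : pd i (pd j (coord p F k)) q =
      fderiv ℝ (fderiv ℝ (cht n p ∘ F)) q (stdVec i) (stdVec j) k := by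
    unfold pd at h1 ⊢
    rw [h1.fderiv_eq, fderiv_coord (hdd.clm_apply (differentiableAt_const _))]
    rw [(hdd.hasFDerivAt.clm_apply (hasFDerivAt_const (stdVec j : Euc n) q)).fderiv]
    simp
  simp only [covDeriv, covHess, h2, chr, pd_coord p hd]
  rfl

theorem volForm_eq (g : LorentzianMetric n M) (p : M) {F : Euc n → M} {q : Euc n}
    (hX : DifferentiableAt ℝ (cht n p ∘ F) q) (v : Fin (n + 1) → ℝ) :
    volForm g p F q v = Real.sqrt |(metricCoeff g p (cht n p (F q))).det| *
      volLin (fun i ↦ (fderiv ℝ (cht n p ∘ F) q (stdVec i)).ofLp) v := by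
  rw [volForm, volLin_apply]
  simp only [pd_coord p hX]

/-- Pairing with the normal vector is evaluation of the volume form: the metric cancels the inverse
metric in `normalVec`. -/
theorem secondForm_eq (g : LorentzianMetric n M) (p : M) {F : Euc n → M} {q : Euc n}
    (hX : ContDiffAt ℝ 2 (cht n p ∘ F) q) (hq : F q ∈ (cht n p).source) (i j : Fin n) :
    secondForm g p F q i j = Real.sqrt |(metricCoeff g p (cht n p (F q))).det| *
      volLin (fun i ↦ (fderiv ℝ (cht n p ∘ F) q (stdVec i)).ofLp)
        (covHess g p (cht n p ∘ F) q (stdVec i) (stdVec j)).ofLp := by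
  set y := cht n p (F q) with hy
  set A := metricCoeff g p y with hA
  have hinv : A * A⁻¹ = 1 :=
    Matrix.mul_nonsing_inv _ (metricCoeff_isUnit_det g p ((cht n p).map_source hq))
  have hd := hX.differentiableAt two_ne_zero
  set L := volLin (fun i ↦ (fderiv ℝ (cht n p ∘ F) q (stdVec i)).ofLp) with hL
  set v := covHess g p (cht n p ∘ F) q (stdVec i) (stdVec j) with hv
  have h1 : secondForm g p F q i j = ∑ α, ∑ β, A α β * v α *
      ∑ l, A⁻¹ β l * (Real.sqrt |A.det| * L (Pi.single l 1)) := by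
    simp only [secondForm, Matrix.of_apply, covDeriv_eq g p hX, normalVec, volForm_eq g p hd]
    rfl
  have h2 (α : Fin (n + 1)) : ∑ β, A α β * v α *
      ∑ l, A⁻¹ β l * (Real.sqrt |A.det| * L (Pi.single l 1)) =
      v α * (Real.sqrt |A.det| * L (Pi.single α 1)) := by
    have := congrFun (congrArg (fun B ↦ Matrix.mulVec B
      fun l ↦ Real.sqrt |A.det| * L (Pi.single l 1)) hinv) α
    simp only [Matrix.one_mulVec, ← Matrix.mulVec_mulVec] at this
    rw [← this]
    simp only [Matrix.mulVec, dotProduct, Finset.mul_sum]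
    exact Finset.sum_congr rfl fun β _ ↦ Finset.sum_congr rfl fun l _ ↦ by ring
  rw [h1]
  simp only [h2]
  conv_rhs => rw [pi_eq_sum_univ' v.ofLp]
  simp only [map_sum, map_smul, Finset.mul_sum, smul_eq_mul]
  refine Finset.sum_congr rfl fun α _ ↦ ?_
  ring

end Bridge

end

noncomputable section

/-! ### The transversal frame, its Gram matrix, and the normalised normal field. -/

section Frame

variable {n : ℕ}

/-- The frame `e, X_{u_1}, …, X_{u_n}` along a hypersurface `X`. -/
def frame (X : Euc n → Euc (n + 1)) (e : Euc (n + 1)) (q : Euc n) : Fin (n + 1) → Euc (n + 1) :=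
  Fin.cons e fun i ↦ fderiv ℝ X q (stdVec i)

/-- The Gram matrix of the frame `e, X_{u_1}, …, X_{u_n}`. -/
def gramMat (G : Euc (n + 1) → Euc (n + 1) →L[ℝ] Euc (n + 1) →L[ℝ] ℝ) (X : Euc n → Euc (n + 1))
    (e : Euc (n + 1)) (q : Euc n) : Matrix (Fin (n + 1)) (Fin (n + 1)) ℝ :=
  Matrix.of fun a b ↦ G (X q) (frame X e q a) (frame X e q b)

/-- The tangential part of the normal field `ν` with `⟨e, ν⟩ = 1`. -/
def tangentPart (G : Euc (n + 1) → Euc (n + 1) →L[ℝ] Euc (n + 1) →L[ℝ] ℝ)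
    (X : Euc n → Euc (n + 1)) (e : Euc (n + 1)) (q : Euc n) : Euc n :=
  WithLp.toLp 2 fun i ↦ (gramMat G X e q)⁻¹ i.succ 0

/-- The transversal part, and the squared length, of the normal field `ν` with `⟨e, ν⟩ = 1`. -/
def transversalPart (G : Euc (n + 1) → Euc (n + 1) →L[ℝ] Euc (n + 1) →L[ℝ] ℝ)
    (X : Euc n → Euc (n + 1)) (e : Euc (n + 1)) (q : Euc n) : ℝ :=
  (gramMat G X e q)⁻¹ 0 0

variable {G : Euc (n + 1) → Euc (n + 1) →L[ℝ] Euc (n + 1) →L[ℝ] ℝ} {X : Euc n → Euc (n + 1)}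
  {e : Euc (n + 1)} {q : Euc n}

theorem contDiffAt_frame {k m : WithTop ℕ∞} (hX : ContDiffAt ℝ k X q) (hm : m + 1 ≤ k)
    (a : Fin (n + 1)) : ContDiffAt ℝ m (fun x ↦ frame X e x a) q := by
  refine Fin.cases ?_ (fun i ↦ ?_) a
  · simpa [frame] using contDiffAt_const
  · simpa [frame] using (hX.fderiv_right hm).clm_apply contDiffAt_const

theorem contDiffAt_gramMat (hX : ContDiffAt ℝ 3 X q) (hG : ContDiffAt ℝ 2 G (X q))
    (a b : Fin (n + 1)) : ContDiffAt ℝ 2 (fun x ↦ gramMat G X e x a b) q :=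
  ((ContDiffAt.comp (g := G) q hG (hX.of_le (by norm_num))).clm_apply
    (contDiffAt_frame hX (by norm_num) a)).clm_apply (contDiffAt_frame hX (by norm_num) b)

theorem span_frame (hf : LinearIndependent ℝ (frame X e q)) :
    Submodule.span ℝ (Set.range (frame X e q)) = ⊤ :=
  hf.span_eq_top_of_card_eq_finrank (by simp)

/-- A kernel vector of the Gram matrix gives a combination of the frame orthogonal to the whole
frame, hence to everything. -/
theorem gramMat_det_ne_zero (hf : LinearIndependent ℝ (frame X e q))
    (hG : ∀ a, (∀ b, G (X q) a b = 0) → a = 0) : (gramMat G X e q).det ≠ 0 := by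
  intro h0
  obtain ⟨v, hv, h⟩ := Matrix.exists_vecMul_eq_zero_iff.2 h0
  refine hv (funext fun a ↦ ?_)
  have hz : G (X q) (∑ a, v a • frame X e q a) = 0 := by
    ext1 w
    have hlin : (G (X q) (∑ a, v a • frame X e q a)).toLinearMap = 0 := by
      refine LinearMap.ext_on_range (span_frame hf) fun b ↦ ?_
      simpa [Matrix.vecMul, dotProduct, gramMat] using congrFun h b
    exact congrArg (· w) hlin
  exact Fintype.linearIndependent_iff.1 hf v (hG _ fun b ↦ by rw [hz]; simp) a

theorem sum_tangentPart : fderiv ℝ X q (tangentPart G X e q) + transversalPart G X e q • e =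
    ∑ b, (gramMat G X e q)⁻¹ b 0 • frame X e q b := by
  rw [Fin.sum_univ_succ, clm_eq_sum_stdVec (fderiv ℝ X q)]
  exact add_comm _ _

/-- With column 0 of the inverse Gram matrix as coefficients, the normal field is the metric dual of
e in the frame. -/
theorem form_normal (hdet : (gramMat G X e q).det ≠ 0) (a : Fin (n + 1)) :
    G (X q) (frame X e q a)
      (fderiv ℝ X q (tangentPart G X e q) + transversalPart G X e q • e) =
      if a = 0 then 1 else 0 := by
  rw [sum_tangentPart]
  have := congrFun (congrFun (Matrix.mul_nonsing_inv _ (isUnit_iff_ne_zero.2 hdet)) a) 0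
  rw [Matrix.mul_apply, Matrix.one_apply] at this
  rw [← this]
  simp [gramMat, mul_comm]

theorem form_tangent_normal (hdet : (gramMat G X e q).det ≠ 0) (a : Euc n) :
    G (X q) (fderiv ℝ X q a)
      (fderiv ℝ X q (tangentPart G X e q) + transversalPart G X e q • e) = 0 := by
  rw [clm_eq_sum_stdVec (fderiv ℝ X q) a]
  simp only [map_sum, map_smul, _root_.sum_apply, _root_.smul_apply]
  refine Finset.sum_eq_zero fun i _ ↦ ?_
  have := form_normal hdet i.succ
  simp only [frame, Fin.cons_succ, Fin.succ_ne_zero, if_false] at this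
  rw [this, smul_zero]

theorem exists_frame_decomp (hf : LinearIndependent ℝ (frame X e q)) (v : Euc (n + 1)) :
    ∃ a, ∃ r : ℝ, v = fderiv ℝ X q a + r • e := by
  have hv : v ∈ Submodule.span ℝ (Set.range (frame X e q)) := by rw [span_frame hf]; trivial
  obtain ⟨c, hc⟩ := (Submodule.mem_span_range_iff_exists_fun ℝ).1 hv
  refine ⟨WithLp.toLp 2 fun i ↦ c i.succ, c 0, ?_⟩
  rw [← hc, Fin.sum_univ_succ, clm_eq_sum_stdVec (fderiv ℝ X q)]
  exact add_comm _ _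

/-- The volume of `(v, X_{u_1}, …, X_{u_n})` is proportional to `⟨v, ν⟩`. -/
theorem volLin_eq_form_normal (hf : LinearIndependent ℝ (frame X e q))
    (hdet : (gramMat G X e q).det ≠ 0) (v : Euc (n + 1)) :
    volLin (fun i ↦ (fderiv ℝ X q (stdVec i)).ofLp) v.ofLp =
      volLin (fun i ↦ (fderiv ℝ X q (stdVec i)).ofLp) e.ofLp * G (X q) v
        (fderiv ℝ X q (tangentPart G X e q) + transversalPart G X e q • e) := by
  set A : Fin n → Fin (n + 1) → ℝ := fun i ↦ (fderiv ℝ X q (stdVec i)).ofLp with hA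
  set ν := fderiv ℝ X q (tangentPart G X e q) + transversalPart G X e q • e with hν
  -- Two linear forms in v that vanish on the tangent vectors X_{u_i} and agree on e.
  have : (volLin A).comp (WithLp.linearEquiv 2 ℝ (Fin (n + 1) → ℝ)).toLinearMap =
      volLin A e.ofLp • ((G (X q)).flip ν).toLinearMap := by
    refine LinearMap.ext_on_range (span_frame hf) fun a ↦ ?_
    refine Fin.cases ?_ (fun i ↦ ?_) a
    · have h1 : G (X q) e ν = 1 := (form_normal hdet 0).trans (if_pos rfl)
      change volLin A e.ofLp = volLin A e.ofLp * G (X q) e ν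
      rw [h1, mul_one]
    · have h1 : G (X q) (fderiv ℝ X q (stdVec i)) ν = 0 := form_tangent_normal hdet _
      change volLin A (A i) = volLin A e.ofLp * G (X q) (fderiv ℝ X q (stdVec i)) ν
      rw [h1, mul_zero, volLin_apply]
      exact Matrix.det_zero_of_row_eq (i := 0) (j := i.succ) (Fin.succ_ne_zero i).symm rfl
  exact congrArg (· v) this

theorem linearIndependent_frame_iff :
    LinearIndependent ℝ (frame X e q) ↔
      volLin (fun i ↦ (fderiv ℝ X q (stdVec i)).ofLp) e.ofLp ≠ 0 := by
  rw [volLin_apply, ← isUnit_iff_ne_zero, ← Matrix.isUnit_iff_isUnit_det,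
    ← Matrix.linearIndependent_rows_iff_isUnit]
  have h := (WithLp.linearEquiv 2 ℝ (Fin (n + 1) → ℝ)).toLinearMap.linearIndependent_iff
    (v := frame X e q) (LinearEquiv.ker _)
  rw [← h]
  have : (WithLp.linearEquiv 2 ℝ (Fin (n + 1) → ℝ)).toLinearMap ∘ frame X e q =
      (Matrix.of (Matrix.vecCons e.ofLp fun i ↦ (fderiv ℝ X q (stdVec i)).ofLp)).row := by
    funext a
    refine Fin.cases ?_ (fun i ↦ ?_) a <;> rfl
  rw [this]

theorem contDiffAt_volLin {m k : WithTop ℕ∞} (hX : ContDiffAt ℝ k X q) (hm : m + 1 ≤ k) :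
    ContDiffAt ℝ m (fun x ↦ volLin (fun i ↦ (fderiv ℝ X x (stdVec i)).ofLp) e.ofLp) q := by
  simp only [volLin_apply]
  refine contDiffAt_det fun a b ↦ ?_
  have h := (EuclideanSpace.proj (𝕜 := ℝ) b).contDiff.contDiffAt.comp q
    (contDiffAt_frame (e := e) hX hm a)
  refine Fin.cases (fun h ↦ ?_) (fun i h ↦ ?_) a h <;> exact h

/-- A transversal vector to an immersion at a point. -/
theorem exists_linearIndependent_frame (hinj : Function.Injective (fderiv ℝ X q)) :
    ∃ e, LinearIndependent ℝ (frame X e q) := by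
  have hli : LinearIndependent ℝ fun i : Fin n ↦ fderiv ℝ X q (stdVec i) := by
    rw [Fintype.linearIndependent_iff]
    intro c hc i
    have : fderiv ℝ X q (WithLp.toLp 2 c) = 0 := by rw [clm_eq_sum_stdVec]; exact hc
    have h0 := hinj (this.trans (map_zero _).symm)
    exact congrFun (congrArg WithLp.ofLp h0) i
  have hne : Submodule.span ℝ (Set.range fun i : Fin n ↦ fderiv ℝ X q (stdVec i)) ≠ ⊤ := by
    intro h
    have := finrank_span_eq_card hli
    rw [h, finrank_top] at this
    simp at this
  obtain ⟨e, he⟩ := SetLike.exists_not_mem_of_ne_top _ hne rfl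
  exact ⟨e, linearIndependent_finCons.2 ⟨hli, he⟩⟩

/-- The induced metric of `X`. -/
def inducedMat (G : Euc (n + 1) → Euc (n + 1) →L[ℝ] Euc (n + 1) →L[ℝ] ℝ)
    (X : Euc n → Euc (n + 1)) (q : Euc n) : Matrix (Fin n) (Fin n) ℝ :=
  Matrix.of fun i j ↦ G (X q) (fderiv ℝ X q (stdVec i)) (fderiv ℝ X q (stdVec j))

theorem inducedMat_eq : inducedMat G X q = (gramMat G X e q).submatrix Fin.succ Fin.succ := rfl

/-- The second fundamental form with respect to the normal vector `ν`, in lowered form. -/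
def lowSecond (G : Euc (n + 1) → Euc (n + 1) →L[ℝ] Euc (n + 1) →L[ℝ] ℝ)
    (X : Euc n → Euc (n + 1)) (ν : Euc (n + 1)) (q a b : Euc n) : ℝ :=
  G (X q) (fderiv ℝ (fderiv ℝ X) q a b) ν +
    christoffelLow G (X q) (fderiv ℝ X q a) (fderiv ℝ X q b) ν

theorem lowSecond_eq_sum (ν : Euc (n + 1)) (a b : Euc n) :
    lowSecond G X ν q a b = ∑ i, ∑ j, a i * b j * lowSecond G X ν q (stdVec i) (stdVec j) := by
  let B : Euc n →ₗ[ℝ] Euc n →ₗ[ℝ] ℝ := LinearMap.mk₂ ℝ (lowSecond G X ν q)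
    (fun _ _ _ ↦ by simp [lowSecond, christoffelLow]; ring)
    (fun _ _ _ ↦ by simp [lowSecond, christoffelLow]; ring)
    (fun _ _ _ ↦ by simp [lowSecond, christoffelLow]; ring)
    (fun _ _ _ ↦ by simp [lowSecond, christoffelLow]; ring)
  change B a b = ∑ i, ∑ j, a i * b j * B (stdVec i) (stdVec j)
  conv_lhs => rw [eq_sum_stdVec a, eq_sum_stdVec b]
  simp only [map_sum, map_smul, LinearMap.sum_apply, LinearMap.smul_apply, smul_eq_mul,
    Finset.mul_sum]
  rw [Finset.sum_comm]
  exact Finset.sum_congr rfl fun i _ ↦ Finset.sum_congr rfl fun j _ ↦ by ring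

theorem contDiffAt_transversalPart (hX : ContDiffAt ℝ 3 X q) (hG : ContDiffAt ℝ 2 G (X q))
    (hdet : (gramMat G X e q).det ≠ 0) : ContDiffAt ℝ 2 (transversalPart G X e) q :=
  contDiffAt_inv_apply (contDiffAt_gramMat hX hG) hdet 0 0

theorem contDiffAt_tangentPart (hX : ContDiffAt ℝ 3 X q) (hG : ContDiffAt ℝ 2 G (X q))
    (hdet : (gramMat G X e q).det ≠ 0) : ContDiffAt ℝ 2 (tangentPart G X e) q :=
  contDiffAt_euclidean.2 fun i ↦ contDiffAt_inv_apply (contDiffAt_gramMat hX hG) hdet i.succ 0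

theorem eventually_gramMat_det_ne_zero (hX : ContDiffAt ℝ 3 X q) (hG : ContDiffAt ℝ 2 G (X q))
    (hdet : (gramMat G X e q).det ≠ 0) : ∀ᶠ x in 𝓝 q, (gramMat G X e x).det ≠ 0 :=
  (contDiffAt_det (contDiffAt_gramMat hX hG)).continuousAt.eventually_ne hdet

theorem gramMat_transpose (hsymm : ∀ a b, G (X q) a b = G (X q) b a) :
    (gramMat G X e q).transpose = gramMat G X e q := by
  ext a b
  exact hsymm _ _

/-- If the trace of the second fundamental form is `φ`, the derivative of the squared length of the
normal field in the direction of its tangential part is divisible by that length. -/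
theorem fderiv_transversalPart_of_trace {φ : ℝ} (hX : ContDiffAt ℝ 3 X q)
    (hG : ContDiffAt ℝ 2 G (X q)) (hsymm : ∀ᶠ y in 𝓝 (X q), ∀ a b, G y a b = G y b a)
    (hdet : (gramMat G X e q).det ≠ 0) (hl : transversalPart G X e q ≠ 0)
    (htr : ∑ i, ∑ j, (inducedMat G X q)⁻¹ i j * lowSecond G X
      (fderiv ℝ X q (tangentPart G X e q) + transversalPart G X e q • e) q
      (stdVec i) (stdVec j) = φ) :
    fderiv ℝ (transversalPart G X e) q (tangentPart G X e q) = transversalPart G X e q *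
      (2 * φ - 2 * ∑ i : Fin n, ∑ j : Fin n, (gramMat G X e q)⁻¹ i.succ j.succ * lowSecond G X
        (fderiv ℝ X q (tangentPart G X e q) + transversalPart G X e q • e) q
        (stdVec i) (stdVec j) -
      fderiv ℝ G (X q) e (fderiv ℝ X q (tangentPart G X e q))
        (fderiv ℝ X q (tangentPart G X e q)) -
      transversalPart G X e q * fderiv ℝ G (X q) (fderiv ℝ X q (tangentPart G X e q)) e e) := by
  set ν := fderiv ℝ X q (tangentPart G X e q) + transversalPart G X e q • e with hν
  set w := fderiv ℝ X q (tangentPart G X e q) with hw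
  set l := transversalPart G X e q with hldef
  -- Block inversion splits off from the trace the only term singular at l = 0, namely II(ξ, ξ) / l.
  have hN : φ = ∑ i : Fin n, ∑ j : Fin n, (gramMat G X e q)⁻¹ i.succ j.succ *
      lowSecond G X ν q (stdVec i) (stdVec j) -
      lowSecond G X ν q (tangentPart G X e q) (tangentPart G X e q) / l := by
    rw [← htr, lowSecond_eq_sum ν (tangentPart G X e q), Finset.sum_div, ← Finset.sum_sub_distrib]
    refine Finset.sum_congr rfl fun i _ ↦ ?_
    rw [Finset.sum_div, ← Finset.sum_sub_distrib]
    refine Finset.sum_congr rfl fun j _ ↦ ?_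
    rw [inducedMat_eq (e := e),
      inv_submatrix_succ hdet (gramMat_transpose hsymm.self_of_nhds) hl]
    simp only [tangentPart, hldef, transversalPart]
    ring
  have hG1 : DifferentiableAt ℝ G (X q) := hG.differentiableAt two_ne_zero
  have hev := eventually_gramMat_det_ne_zero hX hG hdet
  -- With ν = w + l e, the formula for dl(ξ) becomes -2 II(ξ, ξ) - l ∂_e G(w, w) - l² ∂_w G(e, e),
  -- and `hN` replaces II(ξ, ξ) by a multiple of l.
  obtain ⟨-, -, -, key⟩ := fderiv_normal_sq (e := e) (hX.of_le (by norm_num)) hG1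
    hsymm.self_of_nhds ((contDiffAt_tangentPart hX hG hdet).differentiableAt two_ne_zero)
    ((contDiffAt_transversalPart hX hG hdet).differentiableAt two_ne_zero)
    (hev.mono fun x hx ↦ form_tangent_normal hx)
    (hev.mono fun x hx ↦ (form_normal hx 0).trans (if_pos rfl)) (tangentPart G X e q)
  have hs := fderiv_symm hG1 hsymm
  have hlow : lowSecond G X ν q (tangentPart G X e q) (tangentPart G X e q) =
      G (X q) (fderiv ℝ (fderiv ℝ X) q (tangentPart G X e q) (tangentPart G X e q)) ν +
      christoffelLow G (X q) w w ν := rfl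
  rw [← hw, ← hldef, ← hν] at key
  rw [key, hN]
  have hl' : l ≠ 0 := hl
  field_simp
  rw [hlow, christoffelLow]
  simp only [hν, map_add, map_smul, _root_.add_apply, _root_.smul_apply, smul_eq_mul]
  rw [hs w e w]
  ring

end Frame

end

/-! ### Change of charts, and the null geodesic in the manifold. -/

section Main

variable {n : ℕ} {M : Type*} [TopologicalSpace M] [ChartedSpace (Euc (n + 1)) M]
  [IsManifold 𝓘(ℝ, Euc (n + 1)) ∞ M]

theorem gform_covHess {E : Type*} [NormedAddCommGroup E] [NormedSpace ℝ E]
    (g : LorentzianMetric n M) (p : M) {X : E → Euc (n + 1)} {q : E}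
    (hq : X q ∈ (cht n p).target) (a b : E) (z : Euc (n + 1)) :
    gform g p (X q) (covHess g p X q a b) z = gform g p (X q) (fderiv ℝ (fderiv ℝ X) q a b) z +
      christoffelLow (gform g p) (X q) (fderiv ℝ X q a) (fderiv ℝ X q b) z := by
  simp only [covHess, map_add, _root_.add_apply, gform_chr g p hq]

/-- The covariant acceleration vanishes in the chart at `γ t` if it vanishes in another chart. -/
theorem covAccel_eq_zero (g : LorentzianMetric n M) (p : M) {γ : ℝ → M} {t : ℝ}
    (hγ : ContMDiffAt 𝓘(ℝ, ℝ) 𝓘(ℝ, Euc (n + 1)) 2 γ t) (hp : γ t ∈ (cht n p).source)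
    (h : covHess g p (cht n p ∘ γ) t 1 1 = 0) (k : Fin (n + 1)) : covAccel g γ t k = 0 := by
  set x := cht n p ∘ γ with hx
  set y := cht n (γ t) ∘ γ with hy
  have hx2 : ContDiffAt ℝ 2 x t := contDiffAt_cht_comp (k := 2) p hγ hp
  have hy2 : ContDiffAt ℝ 2 y t := contDiffAt_cht_comp (k := 2) (γ t) hγ (mem_extChartAt_source _)
  have hxt : (cht n p).symm (x t) = γ t := (cht n p).left_inv hp
  have hxy : y =ᶠ[𝓝 t] trans n p (γ t) ∘ x := by
    filter_upwards [hγ.continuousAt ((isOpen_cht_source p).mem_nhds hp)] with s hs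
    simp only [trans, hx, hy, Function.comp_apply]
    rw [(cht n p).left_inv hs]
  have h1 : covHess g (γ t) y t 1 1 = 0 := by
    have e1 : covHess g (γ t) y t 1 1 = covHess g (γ t) (trans n p (γ t) ∘ x) t 1 1 := by
      unfold covHess
      rw [hxy.fderiv.fderiv_eq, hxy.fderiv_eq, hxy.eq_of_nhds]
    rw [e1, covHess_trans g p (γ t) hx2 ((cht n p).map_source hp)
      (by rw [hxt]; exact mem_extChartAt_source _), h, map_zero]
  have hd1 (α : Fin (n + 1)) : deriv (fun s ↦ cht n (γ t) (γ s) α) =ᶠ[𝓝 t]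
      fun s ↦ fderiv ℝ y s 1 α := by
    filter_upwards [hy2.eventually (by simp)] with s hs
    exact fderiv_coord (X := y) (hs.differentiableAt two_ne_zero) α 1
  have hdd : DifferentiableAt ℝ (fderiv ℝ y) t :=
    (hy2.fderiv_right (m := 1) (by norm_num)).differentiableAt one_ne_zero
  have hd2 (α : Fin (n + 1)) : deriv (deriv (fun s ↦ cht n (γ t) (γ s) α)) t =
      fderiv ℝ (fderiv ℝ y) t 1 1 α := by
    rw [(hd1 α).deriv_eq, ← fderiv_apply_one_eq_deriv,
      fderiv_coord (hdd.clm_apply (differentiableAt_const _)),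
      (hdd.hasFDerivAt.clm_apply (hasFDerivAt_const (1 : ℝ) t)).fderiv]
    simp
  have h2 := congrFun (congrArg WithLp.ofLp h1) k
  simp only [covAccel, hd2, (hd1 _).self_of_nhds]
  exact h2

/-- If the mean curvature vanishes at a point, then so does the trace of the second fundamental
form in any chart. -/
theorem trace_secondForm_eq_zero (hn : n ≠ 0) (g : LorentzianMetric n M) (p : M) {F : Euc n → M}
    {q : Euc n} (hF : ContMDiffAt 𝓘(ℝ, Euc n) 𝓘(ℝ, Euc (n + 1)) 3 F q)
    (hinj : Function.Injective (fderiv ℝ (cht n (F q) ∘ F) q))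
    (hq : F q ∈ (cht n p).source) (hB : BF g F q ≠ 0) (h : meanCurvature g F q = 0) :
    ∑ i, ∑ j, (firstForm g F q)⁻¹ i j * secondForm g p F q i j = 0 := by
  have hX : ContDiffAt ℝ 3 (cht n p ∘ F) q := contDiffAt_cht_comp (k := 3) p hF hq
  set p' := F q with hp'
  have hq' : F q ∈ (cht n p').source := mem_extChartAt_source _
  have hY : ContDiffAt ℝ 3 (cht n p' ∘ F) q := contDiffAt_cht_comp (k := 3) p' hF hq'
  have hX2 := hX.of_le (m := 2) (by norm_num)
  have hY2 := hY.of_le (m := 2) (by norm_num)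
  set s := (firstForm g F q)⁻¹ with hs
  have hsum (r : M) (hr : F q ∈ (cht n r).source) (hr2 : ContDiffAt ℝ 2 (cht n r ∘ F) q) :
      ∑ i, ∑ j, s i j * secondForm g r F q i j =
      Real.sqrt |(metricCoeff g r (cht n r (F q))).det| *
      volLin (fun i ↦ (fderiv ℝ (cht n r ∘ F) q (stdVec i)).ofLp)
        (∑ i, ∑ j, s i j • covHess g r (cht n r ∘ F) q (stdVec i) (stdVec j)).ofLp := by
    simp only [secondForm_eq g r hr2 hr, WithLp.ofLp_sum, WithLp.ofLp_smul, map_sum, map_smul,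
      Finset.mul_sum, smul_eq_mul]
    exact Finset.sum_congr rfl fun i _ ↦ Finset.sum_congr rfl fun j _ ↦ by ring
  have hsq : Real.sqrt |(metricCoeff g p' (cht n p' (F q))).det| ≠ 0 := by
    have := (metricCoeff_isUnit_det g p' ((cht n p').map_source hq')).ne_zero
    positivity
  have h1 : ∑ i, ∑ j, s i j * secondForm g p' F q i j = 0 := by
    have hB' : Real.sqrt |BF g F q| ≠ 0 := by positivity
    have hn' : (n : ℝ) ≠ 0 := by exact_mod_cast hn
    simp only [meanCurvature, mul_div_assoc', ← Finset.sum_div] at h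
    simpa [hB', hn'] using h
  rw [hsum p' hq' hY2] at h1
  have hxq : (cht n p).symm ((cht n p ∘ F) q) = F q := (cht n p).left_inv hq
  have hy1 : (cht n p ∘ F) q ∈ (cht n p).target := (cht n p).map_source hq
  have hy2 : (cht n p).symm ((cht n p ∘ F) q) ∈ (cht n p').source := by rw [hxq]; exact hq'
  have hXY : cht n p' ∘ F =ᶠ[𝓝 q] trans n p p' ∘ (cht n p ∘ F) := by
    filter_upwards [hF.continuousAt ((isOpen_cht_source p).mem_nhds hq)] with x hx
    simp only [trans, Function.comp_apply]
    rw [(cht n p).left_inv hx]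
  set T := fderiv ℝ (trans n p p') ((cht n p ∘ F) q) with hT
  have hTinj : Function.Injective T := LinearMap.injective_iff_surjective
    (f := T.toLinearMap).2 (fderiv_trans_surjective g p p' hy1 hy2)
  have hdY : fderiv ℝ (cht n p' ∘ F) q = T.comp (fderiv ℝ (cht n p ∘ F) q) := by
    rw [hXY.fderiv_eq]
    exact fderiv_comp q ((contDiffAt_trans p p' hy1 hy2).differentiableAt (by simp))
      (hX2.differentiableAt two_ne_zero)
  have hcY (a b : Euc n) : covHess g p' (cht n p' ∘ F) q a b =
      T (covHess g p (cht n p ∘ F) q a b) := by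
    rw [← covHess_trans g p p' hX2 hy1 hy2]
    unfold covHess
    rw [hXY.fderiv.fderiv_eq, hXY.fderiv_eq, hXY.eq_of_nhds]
  have hli (r : M) (hinjr : Function.Injective (fderiv ℝ (cht n r ∘ F) q)) : LinearIndependent ℝ
      fun i ↦ (fderiv ℝ (cht n r ∘ F) q (stdVec i)).ofLp := by
    obtain ⟨e, he⟩ := exists_linearIndependent_frame hinjr
    exact (linearIndependent_finCons.1 he).1.map' (WithLp.linearEquiv 2 ℝ _).toLinearMap
      (LinearEquiv.ker _)
  have hinjX : Function.Injective (fderiv ℝ (cht n p ∘ F) q) := by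
    rw [hdY] at hinj
    exact Function.Injective.of_comp hinj
  have hspan (r : M) (a : Euc (n + 1)) :
      a.ofLp ∈ Submodule.span ℝ (Set.range fun i ↦ (fderiv ℝ (cht n r ∘ F) q (stdVec i)).ofLp) ↔
      ∃ u, fderiv ℝ (cht n r ∘ F) q u = a := by
    rw [Submodule.mem_span_range_iff_exists_fun]
    constructor
    · rintro ⟨c, hc⟩
      refine ⟨WithLp.toLp 2 c, ?_⟩
      rw [clm_eq_sum_stdVec]
      apply WithLp.ofLp_injective 2
      rw [← hc]
      simp
    · rintro ⟨u, rfl⟩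
      refine ⟨u.ofLp, ?_⟩
      rw [clm_eq_sum_stdVec _ u]
      simp
  rw [hsum p hq hX2, (volLin_eq_zero_iff (hli p hinjX) _).2, mul_zero]
  -- A zero trace means that the traced second covariant derivative is tangent to the hypersurface.
  -- The differential of the transition map carries this vector and the tangent space from one chart
  -- to the other.
  rw [mul_eq_zero, or_iff_right hsq, volLin_eq_zero_iff (hli p' hinj), hspan] at h1
  obtain ⟨u, hu⟩ := h1
  refine (hspan p _).2 ⟨u, hTinj ?_⟩
  rw [hdY] at hu
  refine hu.trans ?_
  simp only [hcY, map_sum, map_smul]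

theorem mfderiv_injective_iff (p : M) {F : Euc n → M} {q : Euc n}
    (hF : ContMDiffAt 𝓘(ℝ, Euc n) 𝓘(ℝ, Euc (n + 1)) 1 F q) (hq : F q ∈ (cht n p).source) :
    Function.Injective (mfderiv 𝓘(ℝ, Euc n) 𝓘(ℝ, Euc (n + 1)) F q) ↔
      Function.Injective (fderiv ℝ (cht n p ∘ F) q) := by
  have h := mfderiv_eq_dsymm p hF hq
  have hd := dsymm_injective p ((cht n p).map_source hq)
  constructor
  · intro hinj a b hab
    exact hinj ((h a).trans (Eq.trans (by rw [hab]) (h b).symm))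
  · intro hinj a b hab
    exact hinj (hd ((h a).symm.trans (Eq.trans hab (h b))))

theorem firstForm_eq (g : LorentzianMetric n M) (p : M) {F : Euc n → M} {q : Euc n}
    (hF : ContMDiffAt 𝓘(ℝ, Euc n) 𝓘(ℝ, Euc (n + 1)) 1 F q) (hq : F q ∈ (cht n p).source) :
    firstForm g F q = inducedMat (gform g p) (cht n p ∘ F) q := by
  ext i j
  exact inner_mfderiv g p hF hq _ _

theorem BF_eq (g : LorentzianMetric n M) (p : M) {F : Euc n → M} {q : Euc n} {e : Euc (n + 1)}
    (hF : ContMDiffAt 𝓘(ℝ, Euc n) 𝓘(ℝ, Euc (n + 1)) 1 F q) (hq : F q ∈ (cht n p).source)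
    (hdet : (gramMat (gform g p) (cht n p ∘ F) e q).det ≠ 0) :
    BF g F q = transversalPart (gform g p) (cht n p ∘ F) e q *
      (gramMat (gform g p) (cht n p ∘ F) e q).det := by
  rw [BF, firstForm_eq g p hF hq, inducedMat_eq (e := e), det_submatrix_succ hdet]
  rfl

/-- At a zero of l the differential of l D is D dl. It is used with the factorisation `BF_eq`, D
being the Gram determinant. -/
theorem isDegenerateLightlikePoint_iff {g : LorentzianMetric n M} {F : Euc n → M} {q : Euc n}
    {l D : Euc n → ℝ} (h : BF g F =ᶠ[𝓝 q] fun x ↦ l x * D x) (hl : DifferentiableAt ℝ l q)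
    (hD : DifferentiableAt ℝ D q) (hD0 : D q ≠ 0) :
    IsDegenerateLightlikePoint g F q ↔ l q = 0 ∧ fderiv ℝ l q = 0 := by
  have h1 : IsLightlikePoint g F q ↔ l q = 0 := by
    rw [IsLightlikePoint, h.eq_of_nhds]
    simp [hD0]
  unfold IsDegenerateLightlikePoint
  rw [h1]
  refine and_congr_right fun h0 ↦ ?_
  have h2 : HasFDerivAt (fun x ↦ l x * D x) _ q := hl.hasFDerivAt.mul hD.hasFDerivAt
  rw [h.fderiv_eq, h2.fderiv, h0]
  simp [hD0]

-- Second derivatives of a C^3 map are C^1. This is the regularity ψ needs, since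
-- `eventually_degenerate_zero` differentiates it once.
set_option maxSynthPendingDepth 3 in
theorem contDiffAt_lowSecond {G : Euc (n + 1) → Euc (n + 1) →L[ℝ] Euc (n + 1) →L[ℝ] ℝ}
    {X : Euc n → Euc (n + 1)} {ν : Euc n → Euc (n + 1)} {o : Euc n} (hX : ContDiffAt ℝ 3 X o)
    (hG : ContDiffAt ℝ 2 G (X o)) (hν : ContDiffAt ℝ 1 ν o) (a b : Euc n) :
    ContDiffAt ℝ 1 (fun q ↦ lowSecond G X (ν q) q a b) o := by
  have hX1 : ContDiffAt ℝ 1 X o := hX.of_le (by norm_num)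
  have hdX2 : ContDiffAt ℝ 2 (fderiv ℝ X) o := hX.fderiv_right (by norm_num)
  have hddX : ContDiffAt ℝ 1 (fderiv ℝ (fderiv ℝ X)) o := hdX2.fderiv_right (by norm_num)
  have hd (a : Euc n) : ContDiffAt ℝ 1 (fun q ↦ fderiv ℝ X q a) o :=
    (hdX2.of_le (by norm_num)).clm_apply contDiffAt_const
  have hdG : ContDiffAt ℝ 1 (fun q ↦ fderiv ℝ G (X q)) o :=
    ContDiffAt.comp (g := fderiv ℝ G) o (hG.fderiv_right (by norm_num)) hX1
  have hGX : ContDiffAt ℝ 1 (fun q ↦ G (X q)) o :=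
    ContDiffAt.comp (g := G) o (hG.of_le (by norm_num)) hX1
  have h3 {u v w : Euc n → Euc (n + 1)} (hu : ContDiffAt ℝ 1 u o) (hv : ContDiffAt ℝ 1 v o)
      (hw : ContDiffAt ℝ 1 w o) : ContDiffAt ℝ 1 (fun q ↦ fderiv ℝ G (X q) (u q) (v q) (w q)) o :=
    ((hdG.clm_apply hu).clm_apply hv).clm_apply hw
  exact ((hGX.clm_apply ((hddX.clm_apply contDiffAt_const).clm_apply contDiffAt_const)).clm_apply
    hν).add (contDiffAt_const.mul (((h3 (hd a) (hd b) hν).add (h3 (hd b) (hd a) hν)).sub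
      (h3 hν (hd a) (hd b))))

set_option maxSynthPendingDepth 3 in
/-- The squared length `l` of the normal field of a hypersurface satisfies `dl(ξ) = l ψ` with `ψ` of
class `C^1`, if the trace of the second fundamental form is the restriction of a `C^1` function. -/
theorem exists_fderiv_transversalPart_eq
    {G : Euc (n + 1) → Euc (n + 1) →L[ℝ] Euc (n + 1) →L[ℝ] ℝ}
    {X : Euc n → Euc (n + 1)} {e : Euc (n + 1)} {o : Euc n} {φ : Euc n → ℝ}
    (hX : ContDiffAt ℝ 3 X o) (hG : ContDiffAt ℝ 2 G (X o)) (hφ : ContDiffAt ℝ 1 φ o)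
    (hsymm : ∀ᶠ y in 𝓝 (X o), ∀ a b, G y a b = G y b a)
    (hdet : (gramMat G X e o).det ≠ 0)
    (htr : ∀ᶠ q in 𝓝 o, transversalPart G X e q ≠ 0 →
      ∑ i, ∑ j, (inducedMat G X q)⁻¹ i j * lowSecond G X
      (fderiv ℝ X q (tangentPart G X e q) + transversalPart G X e q • e) q
      (stdVec i) (stdVec j) = φ q) :
    ∃ ψ : Euc n → ℝ, ContDiffAt ℝ 1 ψ o ∧ ∀ᶠ q in 𝓝 o, transversalPart G X e q ≠ 0 →
      fderiv ℝ (transversalPart G X e) q (tangentPart G X e q) =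
        transversalPart G X e q * ψ q := by
  have hXt := hX.eventually (by simp)
  have hGt := hX.continuousAt.eventually (hG.eventually (by simp))
  -- The factor from `fderiv_transversalPart_of_trace`: it contains the inverse Gram matrix but not
  -- the inverse of the induced metric, so it is also regular where l = 0.
  refine ⟨fun q ↦ 2 * φ q - 2 * ∑ i : Fin n, ∑ j : Fin n,
      (gramMat G X e q)⁻¹ i.succ j.succ * lowSecond G X
        (fderiv ℝ X q (tangentPart G X e q) + transversalPart G X e q • e) q
        (stdVec i) (stdVec j) -
      fderiv ℝ G (X q) e (fderiv ℝ X q (tangentPart G X e q))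
        (fderiv ℝ X q (tangentPart G X e q)) -
      transversalPart G X e q * fderiv ℝ G (X q) (fderiv ℝ X q (tangentPart G X e q)) e e,
    ?_, ?_⟩
  rotate_left
  · filter_upwards [hXt, hGt, hX.continuousAt.eventually hsymm.eventually_nhds,
      eventually_gramMat_det_ne_zero hX hG hdet, htr] with q h1 h2 h3 h4 h5 hl
    exact fderiv_transversalPart_of_trace h1 h2 h3 h4 hl (h5 hl)
  · have hX1 : ContDiffAt ℝ 1 X o := hX.of_le (by norm_num)
    have hdX : ContDiffAt ℝ 1 (fderiv ℝ X) o := hX.fderiv_right (by norm_num)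
    have hdG : ContDiffAt ℝ 1 (fun q ↦ fderiv ℝ G (X q)) o :=
      ContDiffAt.comp (g := fderiv ℝ G) o (hG.fderiv_right (by norm_num)) hX1
    have hl : ContDiffAt ℝ 1 (transversalPart G X e) o :=
      (contDiffAt_transversalPart hX hG hdet).of_le (by norm_num)
    have hw : ContDiffAt ℝ 1 (fun q ↦ fderiv ℝ X q (tangentPart G X e q)) o :=
      hdX.clm_apply ((contDiffAt_tangentPart hX hG hdet).of_le (by norm_num))
    have hν := hw.add (hl.smul (contDiffAt_const (c := e)))
    have hP (i j : Fin (n + 1)) : ContDiffAt ℝ 1 (fun q ↦ (gramMat G X e q)⁻¹ i j) o :=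
      (contDiffAt_inv_apply (contDiffAt_gramMat hX hG) hdet i j).of_le (by norm_num)
    exact (((contDiffAt_const.mul hφ).sub (contDiffAt_const.mul (ContDiffAt.sum fun i _ ↦
      ContDiffAt.sum fun j _ ↦ (hP i.succ j.succ).mul
        (contDiffAt_lowSecond hX hG hν (stdVec i) (stdVec j))))).sub
      (((hdG.clm_apply contDiffAt_const).clm_apply hw).clm_apply hw)).sub
      (hl.mul (((hdG.clm_apply hw).clm_apply contDiffAt_const).clm_apply contDiffAt_const))

theorem fderiv_fderiv_one_one {V : Type*} [NormedAddCommGroup V] [NormedSpace ℝ V] {x : ℝ → V}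
    {t : ℝ} (hx : ContDiffAt ℝ 2 x t) : fderiv ℝ (fderiv ℝ x) t 1 1 = deriv (deriv x) t := by
  have hdd : DifferentiableAt ℝ (fderiv ℝ x) t :=
    (hx.fderiv_right (m := 1) (by norm_num)).differentiableAt one_ne_zero
  have h : deriv x = fun s ↦ fderiv ℝ x s 1 := rfl
  rw [h, ← fderiv_apply_one_eq_deriv,
    (hdd.hasFDerivAt.clm_apply (hasFDerivAt_const (1 : ℝ) t)).fderiv]
  simp

/-- The null geodesic through a degenerate light-like point of a hypersurface, the trace of whose
second fundamental form is the restriction of a `C^1` function. -/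
theorem containsDegenerateLightlikeGeodesic_of_trace (g : LorentzianMetric n M) {F : Euc n → M}
    {o : Euc n} (ho : IsDegenerateLightlikePoint g F o)
    (hF : ContMDiffAt 𝓘(ℝ, Euc n) 𝓘(ℝ, Euc (n + 1)) 3 F o)
    (hinj : Function.Injective (mfderiv 𝓘(ℝ, Euc n) 𝓘(ℝ, Euc (n + 1)) F o))
    {φ : Euc n → ℝ} (hφ : ContDiffAt ℝ 1 φ o)
    (htr : ∀ᶠ q in 𝓝 o, BF g F q ≠ 0 →
      ∑ i, ∑ j, (firstForm g F q)⁻¹ i j * secondForm g (F o) F q i j = φ q)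
    {U : Set (Euc n)} (hU : U ∈ 𝓝 o) : ContainsDegenerateLightlikeGeodesic g F U o := by
  set p := F o with hp
  have hos : F o ∈ (cht n p).source := mem_extChartAt_source _
  set X := cht n p ∘ F with hXdef
  set G := gform g p with hGdef
  have hot : X o ∈ (cht n p).target := (cht n p).map_source hos
  have hX : ContDiffAt ℝ 3 X o := contDiffAt_cht_comp (k := 3) p hF hos
  have hG : ContDiffAt ℝ 2 G (X o) :=
    (contDiffAt_gform g p hot).of_le (WithTop.coe_le_coe.2 le_top)
  have hsymm : ∀ᶠ y in 𝓝 (X o), ∀ a b, G y a b = G y b a :=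
    Filter.Eventually.of_forall fun y ↦ gform_symm g p y
  -- A coordinate vector transversal at o; kept constant, it remains transversal nearby (`hli`).
  obtain ⟨e, he⟩ := exists_linearIndependent_frame
    ((mfderiv_injective_iff p (hF.of_le (by norm_num)) hos).1 hinj)
  have hdet : (gramMat G X e o).det ≠ 0 :=
    gramMat_det_ne_zero he fun a ha ↦ gform_nondegenerate g p hot ha
  have hdetE := eventually_gramMat_det_ne_zero hX hG hdet
  have hFE : ∀ᶠ q in 𝓝 o, ContMDiffAt 𝓘(ℝ, Euc n) 𝓘(ℝ, Euc (n + 1)) 3 F q :=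
    (contMDiffAt_iff_contMDiffAt_nhds (by simp)).1 hF
  have hsE : ∀ᶠ q in 𝓝 o, F q ∈ (cht n p).source :=
    hF.continuousAt ((isOpen_cht_source p).mem_nhds hos)
  have hli : ∀ᶠ q in 𝓝 o, LinearIndependent ℝ (frame X e q) := by
    have h1 : ContDiffAt ℝ 2 (fun x ↦ volLin (fun i ↦ (fderiv ℝ X x (stdVec i)).ofLp) e.ofLp) o :=
      contDiffAt_volLin hX (by norm_num)
    exact (h1.continuousAt.eventually_ne (linearIndependent_frame_iff.1 he)).mono
      fun q hq ↦ linearIndependent_frame_iff.2 hq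
  have hBE : ∀ᶠ q in 𝓝 o, BF g F q = transversalPart G X e q * (gramMat G X e q).det := by
    filter_upwards [hFE, hsE, hdetE] with q h1 h2 h3 using BF_eq g p (h1.of_le (by norm_num)) h2 h3
  have hl := contDiffAt_transversalPart hX hG hdet
  have hdC : ContDiffAt ℝ 2 (fun q ↦ (gramMat G X e q).det) o :=
    contDiffAt_det (contDiffAt_gramMat hX hG)
  have hdegE : ∀ᶠ q in 𝓝 o, IsDegenerateLightlikePoint g F q ↔
      transversalPart G X e q = 0 ∧ fderiv ℝ (transversalPart G X e) q = 0 := by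
    filter_upwards [hBE.eventually_nhds, hdetE, hl.eventually (by simp),
      hdC.eventually (by simp)] with q h1 h2 h3 h4
    exact isDegenerateLightlikePoint_iff h1 (h3.differentiableAt two_ne_zero)
      (h4.differentiableAt two_ne_zero) h2
  obtain ⟨hlo, hdlo⟩ := hdegE.self_of_nhds.1 ho
  -- The volume of (e, F_{u_1}, …, F_{u_n}). Since ν̃ = vol · ν, the trace with respect to ν is φ /
  -- vol.
  set vol : Euc n → ℝ := fun q ↦ Real.sqrt |(metricCoeff g p (X q)).det| *
    volLin (fun i ↦ (fderiv ℝ X q (stdVec i)).ofLp) e.ofLp with hvol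
  have hvol0 : vol o ≠ 0 := by
    refine mul_ne_zero ?_ (linearIndependent_frame_iff.1 he)
    have := (metricCoeff_isUnit_det g p hot).ne_zero
    positivity
  have hvolC : ContDiffAt ℝ 1 vol o := by
    have h0 := (metricCoeff_isUnit_det g p hot).ne_zero
    have h1 : ContDiffAt ℝ 1 (fun q ↦ (metricCoeff g p (X q)).det) o :=
      contDiffAt_det fun α β ↦ by
        simp only [← gform_stdVec]
        exact ((ContDiffAt.comp (g := G) o (hG.of_le (by norm_num))
          (hX.of_le (by norm_num))).clm_apply contDiffAt_const).clm_apply contDiffAt_const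
    exact ((h1.abs h0).sqrt (abs_ne_zero.2 h0)).mul (contDiffAt_volLin hX (by norm_num))
  obtain ⟨ψ, hψ, hk⟩ := exists_fderiv_transversalPart_eq (e := e) (φ := fun q ↦ φ q / vol q) hX hG
    (hφ.div hvolC hvol0) hsymm hdet (by
      filter_upwards [htr, hFE, hsE, hdetE, hli, hBE, hvolC.continuousAt.eventually_ne hvol0,
        hX.eventually (by simp)] with q h1 h2 h3 h4 h5 h6 h7 h8 hl0
      have hB : BF g F q ≠ 0 := by rw [h6]; exact mul_ne_zero hl0 h4
      rw [eq_div_iff h7, ← h1 hB, firstForm_eq g p (h2.of_le (by norm_num)) h3, Finset.sum_mul]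
      refine Finset.sum_congr rfl fun i _ ↦ ?_
      rw [Finset.sum_mul]
      refine Finset.sum_congr rfl fun j _ ↦ ?_
      rw [secondForm_eq g p (h8.of_le (by norm_num)) h3, volLin_eq_form_normal h5 h4]
      have h9 := gform_covHess g p (X := X) (q := q) ((cht n p).map_source h3) (stdVec i)
        (stdVec j) (fderiv ℝ X q (tangentPart G X e q) + transversalPart G X e q • e)
      simp only [hvol, lowSecond, hGdef]
      rw [h9]
      simp only [hXdef, Function.comp_apply]
      ring)
  obtain ⟨c, hc0, hcC, hc⟩ := exists_null_geodesic (e := e) hX hG hsymm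
    (contDiffAt_tangentPart hX hG hdet) hl hψ (hdetE.mono fun q hq ↦ form_tangent_normal hq)
    (hdetE.mono fun q hq ↦ (form_normal hq 0).trans (if_pos rfl))
    (hli.mono fun q hq ↦ exists_frame_decomp hq) hk hlo hdlo
  have hct : Filter.Tendsto c (𝓝 0) (𝓝 o) := hc0 ▸ hcC.continuousAt
  have hev := hc.and ((hcC.eventually (by simp)).and ((hct.eventually hU).and
    ((hct.eventually hdegE).and ((hct.eventually hFE).and (hct.eventually hsE)))))
  obtain ⟨ε, hε, hall⟩ := Metric.eventually_nhds_iff.1 hev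
  have hI {t : ℝ} (ht : t ∈ Set.Ioo (-ε) ε) := hall (y := t) (by simpa [abs_lt] using ht)
  have hγ {t : ℝ} (ht : t ∈ Set.Ioo (-ε) ε) :
      ContMDiffAt 𝓘(ℝ, ℝ) 𝓘(ℝ, Euc (n + 1)) 2 (fun s ↦ F (c s)) t := by
    obtain ⟨-, h2, -, -, h5, -⟩ := hI ht
    exact (h5.of_le (by norm_num)).comp t h2.contMDiffAt
  have hγx {t : ℝ} (ht : t ∈ Set.Ioo (-ε) ε) : ContDiffAt ℝ 2 (X ∘ c) t :=
    contDiffAt_cht_comp (k := 2) p (hγ ht) (hI ht).2.2.2.2.2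
  refine ⟨ε, hε, c, hc0, fun t ht ↦ (hI ht).2.1.continuousAt.continuousWithinAt, fun t ht ↦ ?_, ?_⟩
  · obtain ⟨h1, -, h3, h4, -⟩ := hI ht
    exact ⟨h3, h4.2 ⟨h1.1, h1.2.1⟩⟩
  · refine ⟨fun t ht ↦ (hγ ht).contMDiffWithinAt, fun t ht k ↦ ?_, fun t ht ↦ ?_, fun t ht ↦ ?_⟩
    all_goals obtain ⟨⟨-, -, hv0, hvv, hgeo⟩, -, -, -, -, hs⟩ := hI ht
    · refine covAccel_eq_zero g p (hγ ht) hs ?_ k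
      have hxt : (X ∘ c) t ∈ (cht n p).target := (cht n p).map_source hs
      refine gform_ext g p (y := (X ∘ c) t) hxt fun z ↦ ?_
      refine (gform_covHess g p (X := X ∘ c) hxt 1 1 z).trans ?_
      rw [fderiv_fderiv_one_one (hγx ht), fderiv_apply_one_eq_deriv, christoffelLow]
      simp only [map_zero, _root_.zero_apply]
      rw [← hgeo z]
      simp only [Function.comp_apply, hGdef]
      ring
    · intro h0
      refine hv0 (dsymm_injective p ((cht n p).map_source hs) ?_)
      rw [map_zero]
      exact (mfderiv_eq_dsymm p ((hγ ht).of_le (by norm_num)) hs 1).symm.trans h0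
    · exact (inner_mfderiv g p ((hγ ht).of_le (by norm_num)) hs 1 1).trans hvv

end Main

end LorentzHypersurface

theorem mainTheorem1 {n : ℕ} (hn : 2 ≤ n) {M : Type*} [TopologicalSpace M]
    [ChartedSpace (LorentzHypersurface.Euc (n + 1)) M]
    [IsManifold 𝓘(ℝ, LorentzHypersurface.Euc (n + 1)) ∞ M]
    (g : LorentzHypersurface.LorentzianMetric n M)
    (F : LorentzHypersurface.Euc n → M) (o : LorentzHypersurface.Euc n)
    (ho : LorentzHypersurface.IsDegenerateLightlikePoint g F o) :
    (LorentzHypersurface.InClassX3 g F o →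
      ∀ U ∈ 𝓝 o, LorentzHypersurface.ContainsDegenerateLightlikeGeodesic g F U o) ∧
    (∀ U : Set (LorentzHypersurface.Euc n), IsOpen U → o ∈ U →
      LorentzHypersurface.IsC3ZeroMeanCurvatureOn g F U →
      LorentzHypersurface.ContainsDegenerateLightlikeGeodesic g F U o) := by
  constructor
  · rintro ⟨⟨W, hW, hoW, hI⟩, φ, hφ, hA⟩ U hU
    refine LorentzHypersurface.containsDegenerateLightlikeGeodesic_of_trace g ho
      (hI.contMDiffOn.contMDiffAt (hW.mem_nhds hoW)) (hI.injective o hoW) hφ ?_ hU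
    filter_upwards [hA] with q hq hB
    -- Where B_F ≠ 0 the adjugate is B_F times the inverse, so A_F = φ B_F says that the trace is φ.
    have h1 : LorentzHypersurface.AF g (F o) F q = LorentzHypersurface.BF g F q *
        ∑ i, ∑ j, (LorentzHypersurface.firstForm g F q)⁻¹ i j *
          LorentzHypersurface.secondForm g (F o) F q i j := by
      simp only [LorentzHypersurface.AF, Finset.mul_sum]
      refine Finset.sum_congr rfl fun i _ ↦ Finset.sum_congr rfl fun j _ ↦ ?_
      rw [Matrix.inv_def, Matrix.smul_apply, Ring.inverse_eq_inv', smul_eq_mul]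
      change _ = LorentzHypersurface.BF g F q * ((LorentzHypersurface.BF g F q)⁻¹ * _ * _)
      field_simp
    rw [h1, mul_comm] at hq
    exact mul_right_cancel₀ hB hq
  · intro U hU hoU hZ
    have hF := hZ.immersion.contMDiffOn.contMDiffAt (hU.mem_nhds hoU)
    -- The trace is 0 off the light-like points, so φ = 0. `meanCurvature` is read in the chart at
    -- `F q`, whence the passage to the chart at `F o`.
    refine LorentzHypersurface.containsDegenerateLightlikeGeodesic_of_trace g ho
      hF (hZ.immersion.injective o hoU) (φ := fun _ ↦ 0) contDiffAt_const ?_ (hU.mem_nhds hoU)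
    filter_upwards [hU.mem_nhds hoU, hF.continuousAt
      ((LorentzHypersurface.isOpen_cht_source (n := n) (F o)).mem_nhds
        (mem_extChartAt_source _))] with q hq hqs hB
    have hFq := hZ.immersion.contMDiffOn.contMDiffAt (hU.mem_nhds hq)
    refine LorentzHypersurface.trace_secondForm_eq_zero (by omega) g (F o) hFq ?_ hqs hB
      (hZ.meanCurvature_eq_zero q hq hB)
    exact (LorentzHypersurface.mfderiv_injective_iff (F q) (hFq.of_le (by norm_num))
      (mem_extChartAt_source _)).1 (hZ.immersion.injective q hq)
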